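/- A proper edge-colouring of a finite simple graph is one in which any two distinct edges with a common end receive distinct colours. A copy of a graph $F$ (as a not necessarily induced subgraph) in an edge-coloured graph is rainbow if its edges have pairwise distinct colours. The rainbow planar Turán number $\mathrm{ex}_{\mathcal P}^{*}(n,F)$ is the maximum number of edges of an $n$-vertex planar graph that has a proper edge-colouring containing no rainbow copy of $F$. Let $P_5$ denote the path on $5$ vertices. Theorem. For every integer $n\ge 4$, $$\mathrm{ex}_{\mathcal P}^{*}(n,P_5)=\left\lfloor \frac{3n}{2}\right\rfloor .$$ That is, every $n$-vertex planar graph with a proper edge-colouring that contains no rainbow $P_5$ has at most $\lfloor 3n/2\rfloor$ edges, and for every $n\ge 4$ some such graph has exactly $\lfloor 3n/2\rfloor$ edges. -/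

import Mathlib

namespace RainbowPlanar

open SimpleGraph

/-- A drawing of `G` in the Euclidean plane without crossings: vertices are distinct points, each
edge is a simple continuous arc joining the points of its two ends, the interior of an arc contains
no vertex, and the interior of an arc is disjoint from every other arc. -/
structure PlaneDrawing {V : Type*} (G : SimpleGraph V) where
  /-- the point representing a vertex -/
  point : V → EuclideanSpace ℝ (Fin 2)
  /-- the arc representing an edge -/
  arc : G.edgeSet → C(unitInterval, EuclideanSpace ℝ (Fin 2))
  point_injective : Function.Injective point
  arc_injective : ∀ e, Function.Injective (arc e)
  arc_ends : ∀ e, s(arc e 0, arc e 1) = Sym2.map point e.1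
  arc_avoids_points : ∀ e t v, arc e t = point v → t = 0 ∨ t = 1
  arcs_disjoint : ∀ e f, e ≠ f → ∀ s t, arc e s = arc f t → s = 0 ∨ s = 1

/-- A graph is planar if it can be drawn in the plane without crossings. -/
def IsPlanar {V : Type*} (G : SimpleGraph V) : Prop :=
  Nonempty (PlaneDrawing G)

/-- An edge-colouring is proper if distinct edges with a common end have distinct colours. -/
def IsProperColoring {V K : Type*} {G : SimpleGraph V} (c : G.EdgeLabeling K) : Prop :=
  ∀ e f : G.edgeSet, e ≠ f → (∃ v, v ∈ e.1 ∧ v ∈ f.1) → c e ≠ c f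

/-- The edge-coloured graph `(G, c)` contains a rainbow `F`: a (not necessarily induced) copy of `F`
in `G` whose edges have pairwise distinct colours. -/
def ContainsRainbow {V W K : Type*} {G : SimpleGraph V} (c : G.EdgeLabeling K)
    (F : SimpleGraph W) : Prop :=
  ∃ f : Copy F G, Function.Injective fun e : F.edgeSet => c (f.toHom.mapEdgeSet e)

/-- The numbers of edges of the `n`-vertex planar graphs that have a proper edge-colouring without
a rainbow `F`. As the graphs are finite, it is no restriction to use natural numbers as colours. -/
def rainbowFreePlanarEdgeCounts {W : Type*} (n : ℕ) (F : SimpleGraph W) : Set ℕ :=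
  {m | ∃ (G : SimpleGraph (Fin n)) (c : G.EdgeLabeling ℕ),
    IsPlanar G ∧ IsProperColoring c ∧ ¬ ContainsRainbow c F ∧ G.edgeSet.ncard = m}

/-- `m` is the rainbow planar Turán number of `F` for `n` vertices: the maximum number of edges of
an `n`-vertex properly edge-coloured planar graph that contains no rainbow `F`. -/
def IsRainbowPlanarTuranNumber {W : Type*} (n : ℕ) (F : SimpleGraph W) (m : ℕ) : Prop :=
  IsGreatest (rainbowFreePlanarEdgeCounts n F) m

end RainbowPlanar

/-! ### Colours forced around a vertex of degree at least four. -/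

namespace RainbowPlanar

/-! The upper bound is a bound `3n` on the degree sum, proved by induction on `n`. A nonempty vertex
set `S` meeting at most `3|S|/2` edges can be deleted, so a minimal counterexample is `Reduced`: its
degrees are at least two and its vertices of degree two are pairwise non-adjacent.

Rainbow-freeness is very restrictive near a vertex `v` of degree at least four, because an outgoing
path `v u x y` can be preceded by an edge `jv` of a colour not used on `ux` and `xy`; hence `xy`
repeats the colour of `vu`. So a vertex at distance two from `v` either has all its neighbours among
those of `v`, or is a tail: a vertex of degree two whose other neighbour is at distance three.

The rest is discharging. A vertex of degree `d ≥ 4` has doubled excess `2d - 6`, paid by pairs `(x,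
y)` of adjacent vertices with `x` of degree two; such an `x` has deficit two and two pairs to give.
A vertex of degree at least five has degree exactly five and four neighbours of degree two
(`Reduced.five`), which pays its excess of four. A vertex of degree four that cannot collect two
pairs is `Poor`.

Around a poor vertex the neighbourhood is independent and there are no tails. The colours at each
vertex at distance two select a perfect matching of the four neighbours, and no two vertices select
the same one. So the component has eight vertices and lies in a `K₄,₄`. Only here does planarity
enter: excluding `K₃,₃`, plain or with one edge replaced by a path of length three, costs at least
four of the sixteen edges. The component then has average degree at most three and is removed by
induction.

That `K₃,₃` is not planar is shown by following continuous logarithms of differences of points on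
disjoint arcs; the resulting integer equations are inconsistent modulo two.

For sharpness, explicit graphs on four to seven vertices are extended by disjoint copies of `K₄`,
each adding four vertices and six edges. -/

/-- A properly edge-coloured simple graph without a rainbow path on five vertices, encoded by a
function of two vertices: `0` means non-adjacent, other values are colours. -/
structure RainbowFree {V : Type*} (f : V → V → ℕ) : Prop where
  symm : ∀ a b, f a b = f b a
  irrefl : ∀ a, f a a = 0
  proper : ∀ a b c, f a b ≠ 0 → f a b = f a c → b = c
  not_rainbow : ∀ a b c d e, f a b ≠ 0 → f b c ≠ 0 → f c d ≠ 0 → f d e ≠ 0 →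
    a ≠ c → a ≠ d → a ≠ e → b ≠ d → b ≠ e → c ≠ e →
    f a b = f c d ∨ f a b = f d e ∨ f b c = f d e

/-- The vertex `x` has at most two neighbours. -/
def DegLeTwo {V : Type*} (f : V → V → ℕ) (x : V) : Prop :=
  ∃ a b, ∀ c, f x c ≠ 0 → c = a ∨ c = b

/-- The vertex `x` has at least four neighbours. -/
def DegGeFour {V : Type*} (f : V → V → ℕ) (x : V) : Prop :=
  ∀ a b c, ∃ u, f x u ≠ 0 ∧ u ≠ a ∧ u ≠ b ∧ u ≠ c

/-- The vertex `x` has at least five neighbours. -/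
def DegGeFive {V : Type*} (f : V → V → ℕ) (x : V) : Prop :=
  ∀ a b c d, ∃ u, f x u ≠ 0 ∧ u ≠ a ∧ u ≠ b ∧ u ≠ c ∧ u ≠ d

/-- A rainbow-free colouring of a graph of minimum degree two in which no two vertices of degree
two are adjacent. -/
structure Reduced {V : Type*} (f : V → V → ℕ) : Prop extends RainbowFree f where
  exists_adj_ne : ∀ x a, ∃ c, f x c ≠ 0 ∧ c ≠ a
  not_adj_degLeTwo : ∀ x y, f x y ≠ 0 → DegLeTwo f x → DegLeTwo f y → False

/-- `x` is a vertex of degree two at distance two from `v`, reached through `u`, whose other edge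
has the colour of `vu`. -/
def IsTail {V : Type*} (f : V → V → ℕ) (v u x y : V) : Prop :=
  f v u ≠ 0 ∧ f u x ≠ 0 ∧ x ≠ v ∧ f v x = 0 ∧ f x y = f v u ∧ y ≠ u ∧ f v y = 0 ∧
    ∀ c, f x c ≠ 0 → c = u ∨ c = y

variable {V : Type*} {f : V → V → ℕ}

theorem RainbowFree.ne (H : RainbowFree f) {a b : V} (h : f a b ≠ 0) : a ≠ b := by
  rintro rfl
  exact h (H.irrefl a)

theorem RainbowFree.path (H : RainbowFree f) (a b c d e : V) (h1 : f a b ≠ 0) (h2 : f b c ≠ 0)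
    (h3 : f c d ≠ 0) (h4 : f d e ≠ 0) :
    a = c ∨ a = d ∨ a = e ∨ b = d ∨ b = e ∨ c = e ∨
      f a b = f c d ∨ f a b = f d e ∨ f b c = f d e := by
  by_contra! h
  have := H.not_rainbow a b c d e h1 h2 h3 h4
  tauto

theorem not_degLeTwo {x : V} (h : ¬ DegLeTwo f x) (a b : V) :
    ∃ c, f x c ≠ 0 ∧ c ≠ a ∧ c ≠ b := by
  by_contra hc
  push Not at hc
  exact h ⟨a, b, fun c h1 => by by_contra h2; push Not at h2; exact h2.2 (hc c h1 h2.1)⟩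

theorem DegGeFive.degGeFour {v : V} (h : DegGeFive f v) : DegGeFour f v := fun a b c => by
  obtain ⟨u, h1, h2, h3, h4, -⟩ := h a b c c
  exact ⟨u, h1, h2, h3, h4⟩

theorem RainbowFree.exists_vertex_of_colour (H : RainbowFree f) (v : V) (α : ℕ) :
    ∃ a, ∀ u, f v u ≠ 0 → f v u = α → u = a := by
  by_cases h : ∃ a, f v a ≠ 0 ∧ f v a = α
  · obtain ⟨a, h1, h2⟩ := h
    exact ⟨a, fun u h3 h4 => H.proper v u a h3 (h4.trans h2.symm)⟩
  · exact ⟨v, fun u h3 h4 => (h ⟨u, h3, h4⟩).elim⟩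

/-- By properness each colour excludes at most one neighbour of `v`, so a vertex and two colours
exclude at most three. The resulting edge `vj` is the free first edge that prolongs paths through
`v`. -/
theorem RainbowFree.exists_avoid (H : RainbowFree f) {v : V} (hv : DegGeFour f v) (u : V)
    (α β : ℕ) : ∃ j, f v j ≠ 0 ∧ j ≠ u ∧ f v j ≠ α ∧ f v j ≠ β := by
  obtain ⟨a, ha⟩ := H.exists_vertex_of_colour v α
  obtain ⟨b, hb⟩ := H.exists_vertex_of_colour v β
  obtain ⟨j, h1, h2, h3, h4⟩ := hv u a b
  exact ⟨j, h1, h2, fun h => h3 (ha j h1 h), fun h => h4 (hb j h1 h)⟩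

theorem RainbowFree.exists_avoid₅ (H : RainbowFree f) {v : V} (hv : DegGeFive f v) (u w : V)
    (α β : ℕ) : ∃ j, f v j ≠ 0 ∧ j ≠ u ∧ j ≠ w ∧ f v j ≠ α ∧ f v j ≠ β := by
  obtain ⟨a, ha⟩ := H.exists_vertex_of_colour v α
  obtain ⟨b, hb⟩ := H.exists_vertex_of_colour v β
  obtain ⟨j, h1, h2, h2', h3, h4⟩ := hv u w a b
  exact ⟨j, h1, h2, h2', fun h => h3 (ha j h1 h), fun h => h4 (hb j h1 h)⟩

/-- A step from a vertex at distance two away from the neighbourhood of `v` repeats the colour of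
the first step. -/
theorem RainbowFree.far_colour (H : RainbowFree f) {v u x y : V} (hv : DegGeFour f v)
    (h1 : f v u ≠ 0) (h2 : f u x ≠ 0) (h3 : x ≠ v) (h4 : f v x = 0) (h5 : f x y ≠ 0)
    (h6 : y ≠ u) (h7 : f v y = 0) : f x y = f v u := by
  -- In `j v u x y` the only repetition left possible is between `vu` and `xy`.
  obtain ⟨j, j1, j2, j3, j4⟩ := H.exists_avoid hv u (f u x) (f x y)
  have := H.path j v u x y
  have := H.symm
  have := H.irrefl
  grind

/-- Two outer edges at different neighbours of `v`. -/
theorem RainbowFree.two_outer (H : RainbowFree f) {v a b x y : V} (ha : f v a ≠ 0)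
    (hb : f v b ≠ 0) (hab : a ≠ b) (hx : f a x ≠ 0) (hy : f b y ≠ 0) (xv : x ≠ v) (yv : y ≠ v)
    (xy : x ≠ y) (xb : x ≠ b) (ya : y ≠ a) :
    f a x = f b y ∨ f a x = f v b ∨ f b y = f v a := by
  have := H.path x a v b y
  have := H.symm
  grind

/-- A vertex `x` with two neighbours `a`, `b` in the neighbourhood of `v`. -/
theorem RainbowFree.common (H : RainbowFree f) {v a b x m : V} (ha : f v a ≠ 0) (hb : f v b ≠ 0)
    (hab : a ≠ b) (hxa : f x a ≠ 0) (hxb : f x b ≠ 0) (xv : x ≠ v) (hm : f v m ≠ 0) (ma : m ≠ a)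
    (mb : m ≠ b) (mx : m ≠ x) : f x b = f v a ∨ f v m = f x a ∨ f v m = f x b := by
  have := H.path m v a x b
  have := H.symm
  have := H.irrefl
  grind

/-- A vertex at distance two from `v` has all its neighbours in the neighbourhood of `v`, or is a
tail. -/
theorem Reduced.nontail_or_tail (H : Reduced f) {v u x : V} (hv : DegGeFour f v)
    (h1 : f v u ≠ 0) (h2 : f u x ≠ 0) (h3 : x ≠ v) (h4 : f v x = 0) :
    (∀ c, f x c ≠ 0 → f v c ≠ 0) ∨ ∃ y, IsTail f v u x y := by
  by_contra! hc
  obtain ⟨⟨y, y1, y2⟩, hc⟩ := hc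
  have y3 : y ≠ u := by rintro rfl; exact h1 y2
  have y4 := H.far_colour hv h1 h2 h3 h4 y1 y3 y2
  apply hc y
  refine ⟨h1, h2, h3, h4, y4, y3, y2, fun z hz => ?_⟩
  -- A further neighbour outside the neighbourhood of `v` would repeat the colour of `xy` at `x`;
  -- one inside it would give `xy` the colour of `vz` besides that of `vu`.
  by_contra! hz'
  by_cases zN : f v z = 0
  · have := H.far_colour hv h1 h2 h3 h4 hz hz'.1 zN
    exact hz'.2 (H.proper x z y hz (by omega))
  · have := H.far_colour hv zN (by rwa [H.symm]) h3 h4 y1 hz'.2.symm y2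
    exact hz'.1 (H.proper v z u zN (by omega))

theorem IsTail.degLeTwo {v u x y : V} (h : IsTail f v u x y) : DegLeTwo f x :=
  ⟨u, y, h.2.2.2.2.2.2.2⟩

/-- The end of a tail is at distance three. -/
theorem Reduced.tail_end (H : Reduced f) {v u x y : V} (hv : DegGeFour f v)
    (t : IsTail f v u x y) {w : V} (hw : f v w ≠ 0) (hwy : f w y ≠ 0) : False := by
  have t2 := t.degLeTwo
  obtain ⟨h1, h2, h3, h4, h5, h6, h7, h8⟩ := t
  have hxy : f x y ≠ 0 := by omega
  have hyv : y ≠ v := by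
    rintro rfl
    rw [H.symm] at hxy
    exact hxy h4
  by_cases hwu : w = u
  · subst hwu
    rcases H.nontail_or_tail hv hw hwy hyv h7 with h | ⟨z, hz⟩
    · exact h x (by rwa [H.symm]) h4
    · exact H.not_adj_degLeTwo x y hxy t2 hz.degLeTwo
  · have := H.far_colour hv hw hwy hyv h7 (by rwa [H.symm] : f y x ≠ 0)
      (by rintro rfl; exact hw h4) h4
    rw [H.symm, h5] at this
    exact hwu (H.proper v w u hw this.symm)

/-- The vertex between `v` and a tail has degree three. -/
theorem Reduced.tail_deg (H : Reduced f) {v u x y : V} (hv : DegGeFour f v)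
    (t : IsTail f v u x y) :
    ∃ w, w ≠ v ∧ w ≠ x ∧ f u w ≠ 0 ∧ ∀ c, f u c ≠ 0 → c = v ∨ c = x ∨ c = w := by
  have t0 := t
  have t2 := t.degLeTwo
  obtain ⟨h1, h2, h3, h4, h5, h6, h7, h8⟩ := t
  have hxy : f x y ≠ 0 := by omega
  have nu := fun h => H.not_adj_degLeTwo u x h2 h t2
  have ny := fun h => H.not_adj_degLeTwo x y hxy t2 h
  obtain ⟨w, w1, w2, w3⟩ := not_degLeTwo nu v x
  refine ⟨w, w2, w3, w1, fun w' w1' => ?_⟩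
  by_contra! hw'
  -- The paths `w u x y z` leave only the colours of `uw` and `ux` for the further edges at `y`.
  -- There are at least two of these, so one has the colour of `uw`, and also that of `uw'`, for two
  -- distinct further neighbours of `u`.
  have key : ∀ w, f u w ≠ 0 → w ≠ v → w ≠ x → ∀ z, f y z ≠ 0 → z ≠ x →
      f y z = f u w ∨ f y z = f u x := by
    intro w w1 w2 w3 z hz hzx
    have wy : f w y = 0 := by
      by_contra wy
      by_cases hw : f v w = 0
      · rcases H.nontail_or_tail hv h1 w1 w2 hw with h | ⟨y', h1', h2', h3', h4', h5', h6', h7', h8'⟩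
        · exact h y wy h7
        · have : y = y' := by
            rcases h8' y wy with h | h
            · exact (h6 h).elim
            · exact h
          subst this
          exact w3 (H.proper y w x (by rwa [H.symm])
            (by rw [H.symm y w, H.symm y x, h5, h5']))
      · exact H.tail_end hv t0 hw wy
    have uy : f u y = 0 := by
      by_contra uy
      exact H.tail_end hv t0 h1 uy
    have := H.path w u x y z
    have := H.symm
    have := H.irrefl
    have := H.proper
    grind
  obtain ⟨z, z1, z2, z3⟩ := not_degLeTwo ny x x
  obtain ⟨z', z1', z2', z3'⟩ := not_degLeTwo ny x z
  have e1 := key w w1 w2 w3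
  have e2 := key w' w1' hw'.1 hw'.2.1
  have := H.proper
  grind

/-- For a vertex with five neighbours, vertices at distance two with two common neighbours. -/
theorem Reduced.common₅ (H : Reduced f) {v a b x : V} (hv : DegGeFive f v) (ha : f v a ≠ 0)
    (hb : f v b ≠ 0) (hab : a ≠ b) (hxa : f x a ≠ 0) (hxb : f x b ≠ 0) (xv : x ≠ v)
    (hx : f v x = 0) : f x b = f v a := by
  obtain ⟨m, m1, m2, m3, m4, m5⟩ := H.exists_avoid₅ hv a b (f x a) (f x b)
  rcases H.common ha hb hab hxa hxb xv m1 m2 m3 (by rintro rfl; exact m1 hx) with h | h | h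
  · exact h
  · exact (m4 h).elim
  · exact (m5 h).elim

/-- With three neighbours `u`, `c`, `b` among those of `v`, the edge `xb` would have the colours of
both `vu` and `vc` by `common₅`. The alternative, a tail, has degree two by definition. -/
theorem Reduced.degLeTwo_of_five (H : Reduced f) {v u x : V} (hv : DegGeFive f v)
    (h1 : f v u ≠ 0) (h2 : f u x ≠ 0) (h3 : x ≠ v) (h4 : f v x = 0) : DegLeTwo f x := by
  rcases H.nontail_or_tail hv.degGeFour h1 h2 h3 h4 with h | ⟨y, hy⟩
  · obtain ⟨b, b1, b2⟩ := H.exists_adj_ne x u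
    refine ⟨u, b, fun c hc => ?_⟩
    by_contra! hcc
    have h2' : f x u ≠ 0 := by rwa [H.symm]
    have e1 := H.common₅ hv h1 (h b b1) b2.symm h2' b1 h3 h4
    have e2 := H.common₅ hv (h c hc) (h b b1) hcc.2 hc b1 h3 h4
    exact hcc.1 (H.proper v c u (h c hc) (by omega))
  · exact hy.degLeTwo

end RainbowPlanar

/-! ### Degree at least five: edges inside the neighbourhood. -/

namespace RainbowPlanar

variable {V : Type*} {f : V → V → ℕ}

/-- An edge inside the neighbourhood of `v` determines the colours of the outer edges at most other
neighbours. -/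
theorem RainbowFree.outer_colour (H : RainbowFree f) {v a b j w : V} (ha : f v a ≠ 0)
    (hb : f v b ≠ 0) (hj : f v j ≠ 0) (hab : f a b ≠ 0) (ja : j ≠ a) (jb : j ≠ b)
    (hc : f v j ≠ f a b) (hw : f j w ≠ 0) (wv : w ≠ v) (wa : w ≠ a) (wb : w ≠ b) :
    f j w = f a b := by
  -- The triangle `v a b` can be traversed in both directions: if `jw` lacked the colour of `ab`, it
  -- would have the colours of both `va` and `vb`.
  have := H.path w j v a b
  have := H.path w j v b a
  have := H.symm
  have := H.irrefl
  have := H.proper v a b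
  grind

/-- If `a` has two neighbours `b`, `c` in the neighbourhood of `v` then, apart from one exception,
every other neighbour of `v` is joined to `v` with the colour of `ab` or of `ac`. -/
theorem RainbowFree.cherry (H : RainbowFree f) {v a b c m : V} (ha : f v a ≠ 0)
    (hb : f v b ≠ 0) (hc : f v c ≠ 0) (hm : f v m ≠ 0) (hab : f a b ≠ 0) (hac : f a c ≠ 0)
    (bc : b ≠ c) (ma : m ≠ a) (mb : m ≠ b) (mc : m ≠ c)
    (hX : ¬ (f a b = f v c ∧ f a c = f v b)) : f v m = f a b ∨ f v m = f a c := by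
  have av : a ≠ v := (H.ne ha).symm
  have h1 := H.common hb hc bc hab hac av hm mb mc ma
  have h2 := H.common hc hb bc.symm hac hab av hm mc mb ma
  grind

/-- The neighbours of the other neighbours of `v` when `a`, `b`, `c` span an exceptional cherry. -/
theorem RainbowFree.exceptional_cherry (H : RainbowFree f) {v a b c m w : V} (ha : f v a ≠ 0)
    (hb : f v b ≠ 0) (hc : f v c ≠ 0) (hm : f v m ≠ 0) (hab : f a b = f v c)
    (hac : f a c = f v b) (bc : b ≠ c) (ma : m ≠ a) (mb : m ≠ b) (mc : m ≠ c)
    (hw : f m w ≠ 0) : w = v ∨ w = a := by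
  by_contra! h
  have p := H.proper v
  have e1 := fun h' => H.outer_colour ha hb hm (by omega) ma mb
    (fun h => mc (p m c hm (by omega))) hw h.1 h.2 h'
  have e2 := fun h' => H.outer_colour ha hc hm (by omega) ma mc
    (fun h => mb (p m b hm (by omega))) hw h.1 h.2 h'
  have := H.symm
  have := H.proper b v m
  have := H.proper c v m
  have := H.ne hm
  have := p b c
  by_cases wb : w = b <;> by_cases wc : w = c <;> grind

/-- A vertex with at least five neighbours spanning an exceptional cherry has exactly five
neighbours, four of which have degree two. -/
theorem Reduced.five_exceptional (H : Reduced f) {v a b c : V} (hv : DegGeFive f v)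
    (ha : f v a ≠ 0) (hb : f v b ≠ 0) (hc : f v c ≠ 0) (hab : f a b = f v c)
    (hac : f a c = f v b) (bc : b ≠ c) :
    ∃ m m', f v m ≠ 0 ∧ f v m' ≠ 0 ∧ b ≠ c ∧ b ≠ m ∧ b ≠ m' ∧ c ≠ m ∧ c ≠ m' ∧ m ≠ m' ∧
      DegLeTwo f b ∧ DegLeTwo f c ∧ DegLeTwo f m ∧ DegLeTwo f m' ∧
      ∀ u, f v u ≠ 0 → u = a ∨ u = b ∨ u = c ∨ u = m ∨ u = m' := by
  obtain ⟨m, m0, ma, mb, mc, -⟩ := hv a b c c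
  obtain ⟨m', m0', ma', mb', mc', mm⟩ := hv a b c m
  have s := H.symm
  have p := H.proper v
  have av : a ≠ v := (H.ne ha).symm
  have key : ∀ m, f v m ≠ 0 → m ≠ a → m ≠ b → m ≠ c → f a m ≠ 0 ∧ ∀ m', f v m' ≠ 0 → m' ≠ a →
      m' ≠ b → m' ≠ c → m' ≠ m → f v m' = f a m := by
    intro m m0 ma mb mc
    obtain ⟨w, w1, w2⟩ := H.exists_adj_ne m v
    have := H.exceptional_cherry ha hb hc m0 hab hac bc ma mb mc w1
    have am : f a m ≠ 0 := by
      rw [s]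
      grind
    refine ⟨am, fun m' m0' ma' mb' mc' mm => ?_⟩
    have := H.common hb m0 mb.symm (by omega) am av m0' mb' mm ma'
    have := H.proper a m c
    grind
  obtain ⟨k1, k2⟩ := key m m0 ma mb mc
  obtain ⟨k1', k2'⟩ := key m' m0' ma' mb' mc'
  have e1 := k2 m' m0' ma' mb' mc' mm
  have e2 := k2' m m0 ma mb mc mm.symm
  have d : ∀ m, f v m ≠ 0 → m ≠ a → m ≠ b → m ≠ c → DegLeTwo f m := fun m m0 ma mb mc =>
    ⟨v, a, fun w hw => H.exceptional_cherry ha hb hc m0 hab hac bc ma mb mc hw⟩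
  -- By `e1` and `e2` the vertices `a`, `m`, `m'` span an exceptional cherry as well, so `b` and `c`
  -- are now in the position of `m` and `m'`.
  have d' : ∀ b, f v b ≠ 0 → b ≠ a → b ≠ m → b ≠ m' → DegLeTwo f b := by
    intro b hb ba bm bm'
    refine ⟨v, a, fun w hw => ?_⟩
    by_contra! h
    have e1 := fun h' => H.outer_colour ha m0 hb k1 ba bm
      (fun h => bm' (p b m' hb (by omega))) hw h.1 h.2 h'
    have e2 := fun h' => H.outer_colour ha m0' hb k1' ba bm'
      (fun h => bm (p b m hb (by omega))) hw h.1 h.2 h'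
    have := p m m'
    have := H.proper m v b
    have := H.proper m' v b
    have := H.ne hb
    by_cases wb : w = m <;> by_cases wc : w = m' <;> grind
  have ba : b ≠ a := (H.ne (by omega)).symm
  have ca : c ≠ a := (H.ne (by omega)).symm
  refine ⟨m, m', m0, m0', bc, mb.symm, mb'.symm, mc.symm, mc'.symm, mm.symm,
    d' b hb ba mb.symm mb'.symm, d' c hc ca mc.symm mc'.symm, d m m0 ma mb mc,
    d m' m0' ma' mb' mc', fun u hu => ?_⟩
  by_contra! h
  have := k2 u hu h.1 h.2.1 h.2.2.1 h.2.2.2.1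
  exact h.2.2.2.2 (p u m' hu (by omega))

/-- If `vj` is not coloured like `ab`, all outer edges at `j` are, so `j` has degree two. Its outer
neighbour `w` must have larger degree; this puts `w` in the neighbourhood of `v` and gives `vw` the
colour of `ab`. Two such `j` would be joined to the same `w` in one colour. -/
theorem Reduced.five_no_isolated (H : Reduced f) {v a b : V} (hv : DegGeFive f v)
    (ha : f v a ≠ 0) (hb : f v b ≠ 0) (hab : f a b ≠ 0)
    (hI : ∀ j, f v j ≠ 0 → j ≠ a → j ≠ b → f a j = 0 ∧ f b j = 0) : False := by
  have s := H.symm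
  have key : ∀ j, f v j ≠ 0 → j ≠ a → j ≠ b → f v j ≠ f a b → DegLeTwo f j ∧
      ∃ w, f v w = f a b ∧ f j w = f a b := by
    intro j hj ja jb hc
    obtain ⟨w, w1, w2⟩ := H.exists_adj_ne j v
    have hw : ∀ w, f j w ≠ 0 → w ≠ v → f j w = f a b := by
      intro w w1 w2
      exact H.outer_colour ha hb hj hab ja jb hc w1 w2 (by grind) (by grind)
    have hj2 : DegLeTwo f j := by
      refine ⟨v, w, fun c hc => ?_⟩
      by_contra! h
      exact h.2 (H.proper j c w hc (by rw [hw c hc h.1, hw w w1 w2]))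
    refine ⟨hj2, w, ?_, hw w w1 w2⟩
    have wN : f v w ≠ 0 := fun h =>
      H.not_adj_degLeTwo j w w1 hj2 (H.degLeTwo_of_five hv hj w1 w2 h)
    by_contra hc'
    have wa : w ≠ a := by
      rintro rfl
      exact w1 (by rw [s]; exact (hI j hj ja jb).1)
    have wb : w ≠ b := by
      rintro rfl
      exact w1 (by rw [s]; exact (hI j hj ja jb).2)
    have := hI w wN wa wb
    refine H.not_adj_degLeTwo j w w1 hj2 ⟨v, j, fun z hz => ?_⟩
    by_contra! h
    have e1 := H.outer_colour ha hb wN hab (by grind) (by grind) hc' hz h.1 (by grind) (by grind)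
    have := hw w w1 w2
    exact h.2 (H.proper w z j hz (by rw [e1, s w j, this]))
  obtain ⟨d, hd⟩ := H.exists_vertex_of_colour v (f a b)
  obtain ⟨j, j1, ja, jb, jd, -⟩ := hv a b d d
  by_cases hdc : f v j = f a b
  · exact jd (hd j j1 hdc)
  obtain ⟨j', j1', ja', jb', jd', jj⟩ := hv a b d j
  obtain ⟨-, w, w1, w2⟩ := key j j1 ja jb hdc
  obtain ⟨-, w', w1', w2'⟩ := key j' j1' ja' jb' (fun h => jd' (hd j' j1' h))
  have : w = w' := H.proper v w w' (by omega) (by omega)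
  subst this
  exact jj (H.proper w j' j (by rw [s]; omega) (by rw [s w j', s w j]; omega))

/-- By `cherry` the further neighbours of `v` are reached in the colours of `ab` and `ac` only; as
there are at least two, both colours occur, at `m` and `m'`. This forces the edges `cm` and `bm'`,
with the colours of `vb` and `vc`. -/
theorem Reduced.five_no_cherry (H : Reduced f) {v a b c : V} (hv : DegGeFive f v)
    (ha : f v a ≠ 0) (hb : f v b ≠ 0) (hc : f v c ≠ 0) (hab : f a b ≠ 0)
    (hac : f a c ≠ 0) (bc : b ≠ c)
    (hX : ∀ a b c, f v a ≠ 0 → f v b ≠ 0 → f v c ≠ 0 → f a b ≠ 0 → f a c ≠ 0 → b ≠ c →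
      ¬ (f a b = f v c ∧ f a c = f v b)) : False := by
  have s := H.symm
  have p := H.proper
  have ir := H.irrefl
  have ab := H.ne hab
  have ac := H.ne hac
  have key : ∀ a b c m m', f v a ≠ 0 → f v b ≠ 0 → f v c ≠ 0 → f v m ≠ 0 → f v m' ≠ 0 →
      f a b ≠ 0 → f a c ≠ 0 → b ≠ c → m ≠ a → m ≠ b → m ≠ c → m' ≠ a → m' ≠ b → m' ≠ c →
      m ≠ m' → f v m = f a b → f v m' = f a c → False := by
    clear hab hac bc ab ac hc hb ha a b c
    have half : ∀ a b c m m', f v a ≠ 0 → f v b ≠ 0 → f v c ≠ 0 → f v m ≠ 0 → f v m' ≠ 0 →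
      f a b ≠ 0 → f a c ≠ 0 → b ≠ c → m ≠ a → m ≠ b → m ≠ c → m' ≠ a → m' ≠ b → m' ≠ c →
      m ≠ m' → f v m = f a b → f v m' = f a c → a ≠ b → a ≠ c → f a m = 0 ∧
        (f c m ≠ 0 → f c m = f v b) ∧ f c m ≠ 0 := by
      intro a b c m m' ha hb hc hm hm' hab hac bc ma mb mc ma' mb' mc' mm e1 e2 ab ac
      have am : f a m = 0 := by
        by_contra am
        have r1 := H.cherry ha hb hm hc hab am mb.symm ac.symm bc.symm mc.symm
          (hX a b m ha hb hm hab am mb.symm)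
        have r2 := H.cherry ha hb hm hm' hab am mb.symm ma' mb' mm.symm
          (hX a b m ha hb hm hab am mb.symm)
        have := p v c m'
        have := p v c m
        have := p v m' m
        grind
      refine ⟨am, fun cm => ?_, fun cm => ?_⟩
      · have r1 := H.cherry hc ha hm hb (by rwa [s]) cm ma.symm bc ab.symm mb.symm
          (hX c a m hc ha hm (by rwa [s]) cm ma.symm)
        have := p v b m'
        grind
      · have mo : ∀ w, f m w ≠ 0 → w ≠ v → f m w = f a c := fun w w1 w2 =>
          H.outer_colour ha hc hm hac ma mc (by have := p v m m'; grind) w1 w2 (by grind)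
            (by grind)
        obtain ⟨w, w1, w2⟩ := H.exists_adj_ne m v
        have m2 : DegLeTwo f m := by
          refine ⟨v, w, fun z hz => ?_⟩
          by_contra! h
          exact h.2 (p m z w hz (by rw [mo z hz h.1, mo w w1 w2]))
        have wN : f v w ≠ 0 := fun h =>
          H.not_adj_degLeTwo m w w1 m2 (H.degLeTwo_of_five hv hm w1 w2 h)
        have ew := mo w w1 w2
        have wb : w ≠ b := by
          rintro rfl
          have r1 := H.cherry hb ha hm hc (by rwa [s]) (by rwa [s]) ma.symm bc.symm
            ac.symm mc.symm (hX w a m hb ha hm (by rwa [s]) (by rwa [s]) ma.symm)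
          have := p v c m
          have := p v c m'
          grind
        have wm : w ≠ m' := by
          rintro rfl
          have := p w m v
          have := H.ne hm
          grind
        have r := H.cherry ha hb hc wN hab hac bc (by grind) wb (by grind)
          (hX a b c ha hb hc hab hac bc)
        have := p v w m
        have := p v w m'
        have := H.ne w1
        grind
    intro a b c m m' ha hb hc hm hm' hab hac bc ma mb mc ma' mb' mc' mm e1 e2
    have ab := H.ne hab
    have ac := H.ne hac
    obtain ⟨-, h1, h2⟩ := half a b c m m' ha hb hc hm hm' hab hac bc ma mb mc ma' mb' mc' mm e1 e2
      ab ac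
    obtain ⟨-, h1', h2'⟩ := half a c b m' m ha hc hb hm' hm hac hab bc.symm ma' mc' mb' ma mc mb
      mm.symm e2 e1 ac ab
    -- The colours along this path are those of `vb`, `vm'`, `vm`, `vc`.
    have := H.path m c a b m'
    have := p v b m'
    have := p v b c
    have := p v m' c
    have := p v m m'
    have := p v b m
    have := p v c m
    grind
  obtain ⟨m, m0, ma, mb, mc, -⟩ := hv a b c c
  obtain ⟨m', m0', ma', mb', mc', mm⟩ := hv a b c m
  have r1 := H.cherry ha hb hc m0 hab hac bc ma mb mc (hX a b c ha hb hc hab hac bc)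
  have r2 := H.cherry ha hb hc m0' hab hac bc ma' mb' mc' (hX a b c ha hb hc hab hac bc)
  have := p v m m'
  rcases r1 with r1 | r1 <;> rcases r2 with r2 | r2
  · grind
  · exact key a b c m m' ha hb hc m0 m0' hab hac bc ma mb mc ma' mb' mc' mm.symm r1 r2
  · exact key a b c m' m ha hb hc m0' m0 hab hac bc ma' mb' mc' ma mb mc mm r2 r1
  · grind

end RainbowPlanar

/-! ### Independent neighbourhoods, and the conclusion for degree at least five. -/

namespace RainbowPlanar

variable {V : Type*} {f : V → V → ℕ}

/-- If the neighbourhood of `v` is independent, then some vertex at distance two is not a tail. -/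
theorem Reduced.exists_nontail (H : Reduced f) {v : V} (hv : DegGeFour f v)
    (hN : ∀ a b, f v a ≠ 0 → f v b ≠ 0 → f a b = 0) :
    ∃ u x, f v u ≠ 0 ∧ f u x ≠ 0 ∧ x ≠ v ∧ f v x = 0 ∧ ∀ c, f x c ≠ 0 → f v c ≠ 0 := by
  by_contra! hc
  have key : ∀ u, f v u ≠ 0 → ∃ x x' y y', IsTail f v u x y ∧ IsTail f v u x' y' ∧ x ≠ x' := by
    intro u hu
    have tl : ∀ x, f u x ≠ 0 → x ≠ v → ∃ y, IsTail f v u x y := by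
      intro x hx xv
      have hx' : f v x = 0 := by
        by_contra h
        exact hx (hN u x hu h)
      rcases H.nontail_or_tail hv hu hx xv hx' with h | h
      · obtain ⟨c, h1, h2⟩ := hc u x hu hx xv hx'
        exact (h c h1 h2).elim
      · exact h
    obtain ⟨x, x1, x2⟩ := H.exists_adj_ne u v
    obtain ⟨y, hy⟩ := tl x x1 x2
    obtain ⟨w, w1, w2, w3, -⟩ := H.tail_deg hv hy
    obtain ⟨z, hz⟩ := tl w w3 w1
    exact ⟨x, w, y, z, hy, hz, w2.symm⟩
  obtain ⟨i, i1, -⟩ := hv v v v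
  obtain ⟨x, x', y, y', t, t', xx⟩ := key i i1
  -- Each neighbour of `v` would precede two tails. With `vj` avoiding both outer colours at `i`,
  -- comparison with the two distinct colours there forces both outer edges at `j` to have the
  -- colour of `vi`.
  obtain ⟨j, j1, j2, j3, j4⟩ := H.exists_avoid hv i (f i x) (f i x')
  obtain ⟨z, z', w, w', s, s', zz⟩ := key j j1
  have cross : ∀ x y z w, IsTail f v i x y → IsTail f v j z w → f v j ≠ f i x →
      f i x = f j z ∨ f j z = f v i := by
    intro x y z w t s hc
    obtain ⟨-, h2, h3, h4, h5, h6, h7, h8⟩ := t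
    obtain ⟨-, k2, k3, k4, k5, k6, k7, k8⟩ := s
    have xz : x ≠ z := by
      rintro rfl
      rcases h8 j (by rwa [H.symm]) with h | h
      · exact j2 h
      · exact j1 (h ▸ h7)
    have := H.two_outer i1 j1 j2.symm h2 k2 h3 k3 xz (by rintro rfl; exact j1 h4)
      (by rintro rfl; exact i1 k4)
    grind
  have c1 := cross x y z w t s j3
  have c2 := cross x' y' z w t' s j4
  have c3 := cross x y z' w' t s' j3
  have c4 := cross x' y' z' w' t' s' j4
  have p1 := H.proper i x x' t.2.1
  have p2 := H.proper j z z' s.2.1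
  grind

/-- A non-tail `x` has exactly two neighbours `a`, `b`, and its edges carry the colours of `vb` and
`va`. Every other `j` then has outer edges in these two colours only. Both occur, since `j` cannot
have degree two next to an outer vertex of degree two, and their ends are private to `j`. Taking one
colour at `j` and the other at `k` gives a rainbow path through `v`. -/
theorem Reduced.five_no_indep (H : Reduced f) {v : V} (hv : DegGeFive f v)
    (hN : ∀ a b, f v a ≠ 0 → f v b ≠ 0 → f a b = 0) : False := by
  have s := H.symm
  have p := H.proper
  have hv4 := hv.degGeFour
  have xN : ∀ u x, f v u ≠ 0 → f u x ≠ 0 → x ≠ v → f v x = 0 := by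
    intro u x hu hx xv
    by_contra h
    exact hx (hN u x hu h)
  have outer : ∀ a b x j w, f v a ≠ 0 → f v b ≠ 0 → a ≠ b → f x a ≠ 0 → f x b ≠ 0 → x ≠ v →
      f v j ≠ 0 → j ≠ a → j ≠ b → f j w ≠ 0 → w ≠ v →
      f j w = f v a ∨ f j w = f v b := by
    intro a b x j w ha hb ab hxa hxb xv hj ja jb hw wv
    have x0 := xN a x ha (by rwa [s]) xv
    have d := H.degLeTwo_of_five hv ha (by rwa [s]) xv x0
    have e1 := H.common₅ hv ha hb ab hxa hxb xv x0
    have e2 := H.common₅ hv hb ha ab.symm hxb hxa xv x0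
    have xw : x ≠ w := by
      rintro rfl
      obtain ⟨c, c', h⟩ := d
      have := h a hxa
      have := h b hxb
      have := h j (by rwa [s])
      grind
    have w0 := xN j w hj hw wv
    have := H.two_outer ha hj ja.symm (by rwa [s]) hw xv wv xw (by rintro rfl; exact hj x0)
      (by rintro rfl; exact ha w0)
    have := s a x
    have := p v b j
    grind
  -- Two vertices `x`, `y` at distance two sharing the neighbour `a` would restrict the outer edges
  -- at some other `j` to the single colour of `va`, giving `j` degree two.
  have aux : ∀ a b x y k, f v a ≠ 0 → f v b ≠ 0 → a ≠ b → f x a ≠ 0 → f x b ≠ 0 → x ≠ v →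
      y ≠ v → y ≠ x → f a y ≠ 0 → f v k ≠ 0 → k ≠ a → f y k ≠ 0 → False := by
    intro a b x y k ha hb ab hxa hxb xv yv yx hay hk ka hyk
    have x0 := xN a x ha (by rwa [s]) xv
    have y0 := xN a y ha hay yv
    have e2 := H.common₅ hv hb ha ab.symm hxb hxa xv x0
    have e3 := H.common₅ hv hk ha ka hyk (by rwa [s]) yv y0
    have kb : k ≠ b := by
      rintro rfl
      exact yx (p a y x hay (by rw [s, e3, s a x, e2]))
    obtain ⟨j, j1, ja, jb, jk, -⟩ := hv a b k k
    have o := fun w hw wv => outer a b x j w ha hb ab hxa hxb xv j1 ja jb hw wv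
    have o' := fun w hw wv => outer a k y j w ha hk ka.symm (by rwa [s]) hyk yv j1 ja jk hw wv
    have o'' : ∀ w, f j w ≠ 0 → w ≠ v → f j w = f v a := by
      intro w hw wv
      have := o w hw wv
      have := o' w hw wv
      have := p v b k hb
      grind
    obtain ⟨w, w1, w2⟩ := H.exists_adj_ne j v
    refine H.not_adj_degLeTwo j w w1 ⟨v, w, fun z hz => ?_⟩
      (H.degLeTwo_of_five hv j1 w1 w2 (xN j w j1 w1 w2))
    by_contra! h
    exact h.2 (p j z w hz (by rw [o'' z hz h.1, o'' w w1 w2]))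
  obtain ⟨a, x, ha, hax, xv, x0, hx⟩ := H.exists_nontail hv4 hN
  obtain ⟨b, xb, ba⟩ := H.exists_adj_ne x a
  have hb := hx b xb
  have xa : f x a ≠ 0 := by rwa [s]
  have tl : ∀ j, f v j ≠ 0 → j ≠ a → j ≠ b → ∃ w w', f j w = f v a ∧ f j w' = f v b ∧ w ≠ v ∧
      w' ≠ v ∧ (∀ k, f v k ≠ 0 → f k w ≠ 0 → k = j) ∧ ∀ k, f v k ≠ 0 → f k w' ≠ 0 → k = j := by
    intro j hj ja jb
    obtain ⟨w, w1, w2⟩ := H.exists_adj_ne j v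
    have nj : ¬ DegLeTwo f j := fun h => H.not_adj_degLeTwo j w w1 h
      (H.degLeTwo_of_five hv hj w1 w2 (xN j w hj w1 w2))
    obtain ⟨w', w1', w2', ww⟩ := not_degLeTwo nj v w
    have t : ∀ w, f j w ≠ 0 → w ≠ v → ∀ k, f v k ≠ 0 → f k w ≠ 0 → k = j := by
      intro w hw wv k hk hkw
      by_contra kj
      have w0 := xN j w hj hw wv
      have wj : f w j ≠ 0 := by rwa [s]
      have wk : f w k ≠ 0 := by rwa [s]
      have wx : w ≠ x := by
        rintro rfl
        obtain ⟨c, c', h⟩ := H.degLeTwo_of_five hv ha hax xv x0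
        have := h a xa
        have := h b xb
        have := h j wj
        grind
      have e := H.common₅ hv hk hj kj wk wj wv w0
      rcases outer a b x j w ha hb ba.symm xa xb xv hj ja jb hw wv with h | h
      · have : k = a := p v k a hk (by rw [← e, s, h])
        subst this
        exact aux k b x w j ha hb ba.symm xa xb xv wv wx hkw hj ja wj
      · have : k = b := p v k b hk (by rw [← e, s, h])
        subst this
        exact aux k a x w j hb ha ba xb xa xv wv wx hkw hj jb wj
    have o := outer a b x j w ha hb ba.symm xa xb xv hj ja jb w1 w2
    have o' := outer a b x j w' ha hb ba.symm xa xb xv hj ja jb w1' w2'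
    have := p j w w'
    rcases o with o | o
    · exact ⟨w, w', o, by grind, w2, w2', t w w1 w2, t w' w1' w2'⟩
    · exact ⟨w', w, by grind, o, w2', w2, t w' w1' w2', t w w1 w2⟩
  obtain ⟨j, j1, ja, jb, -⟩ := hv a b b b
  obtain ⟨k, k1, ka, kb, kj, -⟩ := hv a b j j
  obtain ⟨w, -, w1, -, w2, -, w3, -⟩ := tl j j1 ja jb
  obtain ⟨-, z, -, z1, -, z2, -, z3⟩ := tl k k1 ka kb
  have jw : f j w ≠ 0 := by omega
  have kz : f k z ≠ 0 := by omega
  have := H.two_outer j1 k1 kj.symm jw kz w2 z2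
    (by rintro rfl; exact kj (w3 k k1 kz))
    (by rintro rfl; exact k1 (xN j w j1 jw w2)) (by rintro rfl; exact j1 (xN k z k1 kz z2))
  have := p v a b
  have := p v a k
  have := p v b j
  grind

/-- A vertex with at least five neighbours has exactly five, four of which have degree two. -/
theorem Reduced.five (H : Reduced f) {v : V} (hv : DegGeFive f v) :
    ∃ a b c m m', f v b ≠ 0 ∧ f v c ≠ 0 ∧ f v m ≠ 0 ∧ f v m' ≠ 0 ∧ b ≠ c ∧ b ≠ m ∧ b ≠ m' ∧
      c ≠ m ∧ c ≠ m' ∧ m ≠ m' ∧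
      DegLeTwo f b ∧ DegLeTwo f c ∧ DegLeTwo f m ∧ DegLeTwo f m' ∧
      ∀ u, f v u ≠ 0 → u = a ∨ u = b ∨ u = c ∨ u = m ∨ u = m' := by
  have s := H.symm
  by_cases hX : ∀ a b c, f v a ≠ 0 → f v b ≠ 0 → f v c ≠ 0 → f a b ≠ 0 → f a c ≠ 0 → b ≠ c →
      ¬ (f a b = f v c ∧ f a c = f v b)
  · exfalso
    have hc : ∀ a b c, f v a ≠ 0 → f v b ≠ 0 → f v c ≠ 0 → f a b ≠ 0 → b ≠ c → f a c = 0 := by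
      intro a b c ha hb hc hab bc
      by_contra hac
      exact H.five_no_cherry hv ha hb hc hab hac bc hX
    refine H.five_no_indep hv fun a b ha hb => ?_
    by_contra hab
    exact H.five_no_isolated hv ha hb hab fun j hj ja jb =>
      ⟨hc a b j ha hb hj hab jb.symm, hc b a j hb ha hj (by rwa [s]) ja.symm⟩
  · push Not at hX
    obtain ⟨a, b, c, ha, hb, hc, -, -, bc, h1, h2⟩ := hX
    obtain ⟨m, m', h⟩ := H.five_exceptional hv ha hb hc h1 h2 bc
    exact ⟨a, b, c, m, m', hb, hc, h⟩

end RainbowPlanar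

/-! ### Poor vertices: no cherry and no isolated edge in the neighbourhood. -/

namespace RainbowPlanar

/-- The neighbours of `v` are the four distinct vertices `a`, `b`, `c`, `e`. -/
structure NbrsFour {V : Type*} (f : V → V → ℕ) (v a b c e : V) : Prop where
  ha : f v a ≠ 0
  hb : f v b ≠ 0
  hc : f v c ≠ 0
  he : f v e ≠ 0
  ab : a ≠ b
  ac : a ≠ c
  ae : a ≠ e
  bc : b ≠ c
  be : b ≠ e
  ce : c ≠ e
  all : ∀ u, f v u ≠ 0 → u = a ∨ u = b ∨ u = c ∨ u = e

/-- Around `v` there is at most one vertex of degree two that is a neighbour or a tail of `v`. -/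
structure Poor {V : Type*} (f : V → V → ℕ) (v : V) : Prop where
  nbr : ∀ x y, f v x ≠ 0 → f v y ≠ 0 → DegLeTwo f x → DegLeTwo f y → x = y
  nbr_tail : ∀ z u x y, f v z ≠ 0 → DegLeTwo f z → IsTail f v u x y → False
  tail : ∀ u x y u' x' y', IsTail f v u x y → IsTail f v u' x' y' → x = x'

variable {V : Type*} {f : V → V → ℕ} {v a b c e : V}

theorem NbrsFour.degGeFour (N : NbrsFour f v a b c e) : DegGeFour f v := by
  intro x y z
  obtain ⟨ha, hb, hc, he, ab, ac, ae, bc, be, ce, -⟩ := N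
  by_contra! h
  have := h a ha
  have := h b hb
  have := h c hc
  have := h e he
  by_cases a = x <;> by_cases a = y <;> by_cases b = x <;> by_cases b = y <;> grind

theorem NbrsFour.swap₁₂ (N : NbrsFour f v a b c e) : NbrsFour f v b a c e := by
  obtain ⟨ha, hb, hc, he, ab, ac, ae, bc, be, ce, all⟩ := N
  exact ⟨hb, ha, hc, he, ab.symm, bc, be, ac, ae, ce, fun u hu => by grind⟩

theorem NbrsFour.swap₂₃ (N : NbrsFour f v a b c e) : NbrsFour f v a c b e := by
  obtain ⟨ha, hb, hc, he, ab, ac, ae, bc, be, ce, all⟩ := N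
  exact ⟨ha, hc, hb, he, ac, ab, ae, bc.symm, ce, be, fun u hu => by grind⟩

theorem NbrsFour.swap₃₄ (N : NbrsFour f v a b c e) : NbrsFour f v a b e c := by
  obtain ⟨ha, hb, hc, he, ab, ac, ae, bc, be, ce, all⟩ := N
  exact ⟨ha, hb, he, hc, ab, ae, ac, be, bc, ce.symm, fun u hu => by grind⟩

/-- The colours at a vertex at distance two with two common neighbours. -/
theorem RainbowFree.nontail_colours (H : RainbowFree f) (N : NbrsFour f v a b c e) {x : V}
    (x0 : f v x = 0) (xv : x ≠ v) (xa : f x a ≠ 0) (xb : f x b ≠ 0) :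
    (f x a = f v b ∧ f x b = f v a) ∨ (f x a = f v c ∧ f x b = f v e) ∨
      (f x a = f v e ∧ f x b = f v c) := by
  obtain ⟨ha, hb, hc, he, ab, ac, ae, bc, be, ce, -⟩ := N
  have cx : c ≠ x := by rintro rfl; exact hc x0
  have ex : e ≠ x := by rintro rfl; exact he x0
  have := H.common ha hb ab xa xb xv hc ac.symm bc.symm cx
  have := H.common ha hb ab xa xb xv he ae.symm be.symm ex
  have := H.common hb ha ab.symm xb xa xv hc bc.symm ac.symm cx
  have := H.common hb ha ab.symm xb xa xv he be.symm ae.symm ex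
  have := H.proper v a b
  have := H.proper v c e
  grind

/-- The remaining neighbour `e` sees only `v` and `a`. The triangle `v a e` then fixes the colour of
any further edge at `b`, which leads to a contradiction, so `b` and `e` would both have degree two.
-/
theorem Reduced.poor_no_exceptional (H : Reduced f) (N : NbrsFour f v a b c e) (P : Poor f v)
    (hab : f a b = f v c) (hac : f a c = f v b) : False := by
  have s := H.symm
  have p := H.proper
  have ir := H.irrefl
  have ne := fun a b => H.ne (a := a) (b := b)
  have hv := N.degGeFour
  have N0 := N
  obtain ⟨ha, hb, hc, he, ab, ac, ae, bc, be, ce, all⟩ := N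
  have ee : ∀ w, f e w ≠ 0 → w = v ∨ w = a := fun w hw =>
    H.exceptional_cherry ha hb hc he hab hac bc ae.symm be.symm ce.symm hw
  have e2 : DegLeTwo f e := ⟨v, a, ee⟩
  have hae : f a e ≠ 0 := by
    obtain ⟨w, w1, w2⟩ := H.exists_adj_ne e v
    have := ee w w1
    grind
  have b2 : DegLeTwo f b := by
    refine ⟨v, a, fun w hw => ?_⟩
    by_contra! h
    have we : w ≠ e := by
      rintro rfl
      have := ee b (by rwa [s])
      have := ne v b hb
      grind
    have e1 := H.outer_colour ha he hb hae ab.symm be (by have := p a c e; grind) hw h.1 h.2 we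
    have wc : w ≠ c := by
      rintro rfl
      have := H.path w b a v e
      have := p a e v
      have := p e a v
      have := ne v a
      have := p v w e
      have := p v a w
      have := p v a e
      grind
    have wb : w ≠ b := (ne b w hw).symm
    have w0 : f v w = 0 := by
      by_contra h'
      have := all w h'
      grind
    rcases H.nontail_or_tail hv hb hw h.1 w0 with h' | ⟨y, hy⟩
    · obtain ⟨z, z1, z2⟩ := H.exists_adj_ne w b
      have zN := h' z z1
      rcases all z zN with rfl | rfl | rfl | rfl
      · have := H.nontail_colours N0.swap₁₂ w0 h.1 (by rwa [s]) z1
        have := p z e v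
        have := p z e b
        have := p e z v
        have := ne v z
        grind
      · exact z2 rfl
      · have := H.outer_colour ha he hc hae ac.symm ce (by have := p a b e; grind)
          (by rwa [s]) h.1 h.2 we
        have := p w b z
        grind
      · have := ee w (by rwa [s])
        grind
    · exact P.nbr_tail e b w y he e2 hy
  exact be (P.nbr b e hb he b2 e2)

/-- If a neighbour `a` of `v` is adjacent to the other three neighbours `u`, `n`, `p`, then `u` has
degree two or precedes a tail. -/
theorem Reduced.star_tail (H : Reduced f) {u n p' : V} (N : NbrsFour f v a u n p')
    (hu : f a u = f v n) (hn : f a n = f v p') (hp : f a p' = f v u) :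
    DegLeTwo f u ∨ ∃ x y, IsTail f v u x y := by
  have s := H.symm
  have p := H.proper
  have ne := fun a b => H.ne (a := a) (b := b)
  have hv := N.degGeFour
  have N0 := N
  obtain ⟨ha, hb, hc, he, ab, ac, ae, bc, be, ce, all⟩ := N
  have o1 : ∀ w, f u w ≠ 0 → w ≠ v → w ≠ a → w ≠ n → f u w = f v p' := fun w h1 h2 h3 h4 => by
    rw [← hn]
    exact H.outer_colour ha hc hb (by omega) ab.symm bc
      (by rw [hn]; exact fun h => be (p v u p' hb h)) h1 h2 h3 h4
  have o2 : ∀ w, f n w ≠ 0 → w ≠ v → w ≠ a → w ≠ p' → f n w = f v u := fun w h1 h2 h3 h4 => by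
    rw [← hp]
    exact H.outer_colour ha he hc (by omega) ac.symm ce
      (by rw [hp]; exact fun h => bc (p v n u hc h).symm) h1 h2 h3 h4
  have o3 : ∀ w, f p' w ≠ 0 → w ≠ v → w ≠ a → w ≠ u → f p' w = f v n := fun w h1 h2 h3 h4 => by
    rw [← hu]
    exact H.outer_colour ha hb he (by omega) ae.symm be.symm
      (by rw [hu]; exact fun h => ce (p v p' n he h).symm) h1 h2 h3 h4
  by_cases d : DegLeTwo f u
  · exact Or.inl d
  right
  obtain ⟨w, w1, w2, w3⟩ := not_degLeTwo d v a
  have wn : w ≠ n := by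
    rintro rfl
    have := o2 u (by rwa [s]) (ne v u hb).symm ab.symm be
    have := p u w v
    have := ne v w
    grind
  have cw := o1 w w1 w2 w3 wn
  have wp : w ≠ p' := by
    rintro rfl
    have := p w u v
    have := ne v u
    grind
  have w0 : f v w = 0 := by
    by_contra h'
    have := all w h'
    have := ne u w
    grind
  rcases H.nontail_or_tail hv hb w1 w2 w0 with h' | ⟨y, hy⟩
  · obtain ⟨z, z1, z2⟩ := H.exists_adj_ne w u
    have zN := h' z z1
    have wu : f w u ≠ 0 := by rwa [s]
    exfalso
    rcases all z zN with rfl | rfl | rfl | rfl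
    · have := H.nontail_colours N0.swap₁₂ w0 w2 wu z1
      have := p v z p'
      have := p v n p'
      have := p z u w
      have := ne u w
      grind
    · exact z2 rfl
    · have := H.nontail_colours N0.swap₁₂.swap₂₃ w0 w2 wu z1
      have := o2 w (by rwa [s]) w2 w3 wp
      have := p v a u
      have := p v z p'
      have := p v a p'
      grind
    · have := H.nontail_colours N0.swap₁₂.swap₂₃.swap₃₄.swap₂₃ w0 w2 wu z1
      have := o3 w (by rwa [s]) w2 w3 (ne w u wu)
      have := p v u n
      have := p v z n
      have := p v z a
      grind
  · exact ⟨w, y, hy⟩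

/-- A tail has only one neighbour in the neighbourhood of `v`, so distinct neighbours cannot precede
the same tail; the other cases are excluded by `Poor` directly. -/
theorem Poor.at_most_one (P : Poor f v) (s : ∀ a b, f a b = f b a) {u u' : V} (hu : f v u ≠ 0) (hu' : f v u' ≠ 0)
    (uu : u ≠ u') (h : DegLeTwo f u ∨ ∃ x y, IsTail f v u x y)
    (h' : DegLeTwo f u' ∨ ∃ x y, IsTail f v u' x y) : False := by
  rcases h with h | ⟨x, y, h⟩ <;> rcases h' with h' | ⟨x', y', h'⟩
  · exact uu (P.nbr u u' hu hu' h h')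
  · exact P.nbr_tail u u' x' y' hu h h'
  · exact P.nbr_tail u' u x y hu' h' h
  · obtain rfl := P.tail u x y u' x' y' h h'
    obtain ⟨-, h2, -, -, h5, h6, h7, h8⟩ := h
    obtain ⟨-, k2, -, -, k5, k6, k7, k8⟩ := h'
    have := k8 u (by rwa [s])
    grind

/-- If `ae` is not an edge, `e` is isolated in the neighbourhood and of degree two; its outer
neighbour `w` must be joined to `b`, and `wb` would repeat the colour of `ab`. If `ae` is an edge,
the colours around `a` are forced cyclically and `star_tail` applies to both `b` and `c`. -/
theorem Reduced.poor_no_cherry (H : Reduced f) (N : NbrsFour f v a b c e) (P : Poor f v)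
    (hab : f a b ≠ 0) (hac : f a c ≠ 0)
    (hX : ∀ a b c, f v a ≠ 0 → f v b ≠ 0 → f v c ≠ 0 → f a b ≠ 0 → f a c ≠ 0 → b ≠ c →
      ¬ (f a b = f v c ∧ f a c = f v b)) (hab' : f v e = f a b) : False := by
  have s := H.symm
  have p := H.proper
  have ne := fun a b => H.ne (a := a) (b := b)
  have hv := N.degGeFour
  have N0 := N
  obtain ⟨ha, hb, hc, he, ab, ac, ae, bc, be, ce, all⟩ := N
  by_cases hae : f a e = 0
  · have oe : ∀ w, f e w ≠ 0 → w ≠ v → w ≠ a → w ≠ c → f e w = f a c := fun w h1 h2 h3 h4 =>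
      H.outer_colour ha hc he hac ae.symm ce.symm (by have := p a b c; grind) h1 h2 h3 h4
    have oc : ∀ w, f c w ≠ 0 → w ≠ v → w ≠ a → w ≠ b → f c w = f a b := fun w h1 h2 h3 h4 =>
      H.outer_colour ha hb hc hab ac.symm bc.symm (by have := p v c e; grind) h1 h2 h3 h4
    have ec : f e c = 0 := by
      by_contra h
      have := oc e (by rwa [s]) (ne v e he).symm ae.symm be.symm
      have := p e c v
      have := ne v c
      grind
    have eb : f e b = 0 := by
      by_contra h
      have := oe b h (ne v b hb).symm ab.symm bc
      have := H.cherry hb ha he hc (by rwa [s]) (by rwa [s]) ae bc.symm ac.symm ce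
        (hX b a e hb ha he (by rwa [s]) (by rwa [s]) ae)
      have := p v c e
      have := p c a v
      have := ne v a
      grind
    obtain ⟨w, w1, w2⟩ := H.exists_adj_ne e v
    have wN : ∀ w, f e w ≠ 0 → f v w = 0 := by
      intro w hw
      by_contra h
      have := all w h
      have := ne e w
      grind
    have w0 := wN w w1
    have we : f e w = f a c := oe w w1 w2 (by grind) (by grind)
    have e2 : DegLeTwo f e := by
      refine ⟨v, w, fun z hz => ?_⟩
      by_contra! h
      exact h.2 (p e z w hz (by rw [we]; exact oe z hz h.1 (by grind) (by grind)))
    have wd := not_degLeTwo fun h => H.not_adj_degLeTwo e w w1 e2 h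
    have wN' : ∀ z, f w z ≠ 0 → f v z ≠ 0 := by
      rcases H.nontail_or_tail hv he w1 w2 w0 with h' | ⟨y, hy⟩
      · exact h'
      · exact (P.nbr_tail e e w y he e2 hy).elim
    have we' : f w e ≠ 0 := by rwa [s]
    have colb : f w e = f v b := by
      obtain ⟨z, z1, z2⟩ := H.exists_adj_ne w e
      have := p a c v
      have := p c a v
      have := ne v a
      have := ne v c
      rcases all z (wN' z z1) with rfl | rfl | rfl | rfl
      · have := H.nontail_colours N0.swap₃₄.swap₂₃.swap₁₂ w0 w2 we' z1
        grind
      · have := H.nontail_colours N0.swap₃₄.swap₂₃.swap₁₂.swap₂₃ w0 w2 we' z1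
        grind
      · have := H.nontail_colours N0.swap₃₄.swap₂₃.swap₁₂.swap₂₃.swap₃₄.swap₂₃ w0 w2 we' z1
        grind
      · exact (z2 rfl).elim
    have wc : f w c = 0 := by
      by_contra h
      have := H.nontail_colours N0.swap₃₄.swap₂₃.swap₁₂.swap₂₃.swap₃₄.swap₂₃ w0 w2 we' h
      have := oc w (by rwa [s]) w2 (by grind) (by grind)
      have := p v b c
      have := p v b a
      have := p v e a
      grind
    have wb : f w b ≠ 0 := by
      obtain ⟨z, z1, z2, z3⟩ := wd e a
      have := all z (wN' z z1)
      grind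
    have := H.nontail_colours N0.swap₃₄.swap₂₃.swap₁₂.swap₂₃ w0 w2 we' wb
    have := p v b a
    have := p v b c
    have := p b a w
    grind
  · have r1 := H.cherry ha hb he hc hab hae be ac.symm bc.symm ce
      (hX a b e ha hb he hab hae be)
    have r2 := H.cherry ha hc he hb hac hae ce ab.symm bc be
      (hX a c e ha hc he hac hae ce)
    have := p v c e
    have := p v b c
    have e1 : f a e = f v c := by grind
    have e2 : f a c = f v b := by grind
    exact P.at_most_one s hb hc bc (H.star_tail N0.swap₃₄ (by omega) (by omega) (by omega))
      (H.star_tail N0.swap₂₃ (by omega) (by omega) (by omega))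

/-- Here `e` has degree two, with an outer neighbour `w`, so there are no tails and the other
neighbours of `v` have degree at least three. It follows that `w` is the only outer neighbour of `a`
and of `b`. But `c` has an outer neighbour other than `w`, which then lacks a second neighbour. -/
theorem Reduced.poor_no_isolated (H : Reduced f) (N : NbrsFour f v a b c e) (P : Poor f v)
    (hab : f a b = f v c) (hca : f c a = 0) (hcb : f c b = 0) (hea : f e a = 0)
    (heb : f e b = 0) : False := by
  have s := H.symm
  have p := H.proper
  have ne := fun a b => H.ne (a := a) (b := b)
  have hv := N.degGeFour
  have N0 := N
  obtain ⟨ha, hb, hc, he, ab, ac, ae, bc, be, ce, all⟩ := N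
  have oe : ∀ w, f e w ≠ 0 → w ≠ v → f e w = f v c := fun w h1 h2 => by
    rw [← hab]
    exact H.outer_colour ha hb he (by omega) ae.symm be.symm (by have := p v e c; grind) h1 h2
      (by grind) (by grind)
  have ec : f e c = 0 := by
    by_contra h
    have := oe c h (ne v c hc).symm
    have := p c e v
    have := ne v e
    grind
  obtain ⟨w, w1, w2⟩ := H.exists_adj_ne e v
  have we := oe w w1 w2
  have ew : ∀ z, f e z ≠ 0 → z = v ∨ z = w := by
    intro z hz
    by_contra! h
    exact h.2 (p e z w hz (by rw [we]; exact oe z hz h.1))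
  have e2 : DegLeTwo f e := ⟨v, w, ew⟩
  have nd : ∀ u, f v u ≠ 0 → u ≠ e → ¬ DegLeTwo f u := fun u hu ue h =>
    ue (P.nbr u e hu he h e2)
  have nt : ∀ u x, f v u ≠ 0 → f u x ≠ 0 → x ≠ v → f v x = 0 → ∀ z, f x z ≠ 0 → f v z ≠ 0 := by
    intro u x hu hx xv x0
    rcases H.nontail_or_tail hv hu hx xv x0 with h' | ⟨y, hy⟩
    · exact h'
    · exact (P.nbr_tail e u x y he e2 hy).elim
  have w0 : f v w = 0 := by
    by_contra h
    have := all w h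
    have := ne e w
    grind
  have we' : f w e ≠ 0 := by rwa [s]
  have side : ∀ a b, NbrsFour f v a b c e → f a b = f v c → f c a = 0 → f c b = 0 → f e a = 0 →
      f e b = 0 → (f w a ≠ 0 → f w a = f v b) ∧ ∀ y, f a y ≠ 0 → y ≠ v → y ≠ b → y ≠ w →
        f y a = f v e ∧ f y c = f v b := by
    clear ha hb hab hca hcb hea heb N0 ab ac ae bc be all
    intro a b N hab hca hcb hea heb
    have N0 := N
    obtain ⟨ha, hb, -, -, ab, ac, ae, bc, be, -, all⟩ := N
    refine ⟨fun h => ?_, fun y hy yv yb yw => ?_⟩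
    · have := H.nontail_colours N0.swap₃₄.swap₂₃.swap₁₂ w0 w2 we' h
      have := p v c a
      have := p v c b
      grind
    · have y0 : f v y = 0 := by
        by_contra h
        have := all y h
        have := ne a y
        grind
      have e1 := H.two_outer ha he ae hy w1 yv w2 yw (by grind) (by rintro rfl; exact ha w0)
      have := p a y b
      have := p v c a
      have e1' : f a y = f v e := by grind
      have ya : f y a ≠ 0 := by rwa [s]
      obtain ⟨z, z1, z2⟩ := H.exists_adj_ne y a
      rcases all z (nt a y ha hy yv y0 z z1) with rfl | rfl | rfl | rfl
      · exact (z2 rfl).elim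
      · have := H.nontail_colours N0 y0 yv ya z1
        have := p v e z
        have := p v e c
        have := p z a y
        have := ne a y
        grind
      · have := H.nontail_colours N0.swap₂₃ y0 yv ya z1
        have := p v e b
        have := p v e z
        grind
      · have := ew y (by rwa [s])
        grind
  obtain ⟨wa, sa⟩ := side a b N0 hab hca hcb hea heb
  obtain ⟨wb, sb⟩ := side b a N0.swap₁₂ (by rw [s, hab]) hcb hca heb hea
  -- The path `c y a b w` would carry the colours of `vb`, `ve`, `vc`, `va`.
  have far : ∀ a b, NbrsFour f v a b c e → f a b = f v c → f b w ≠ 0 → f w b = f v a → ∀ y,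
      f y a = f v e ∧ f y c = f v b → f a y ≠ 0 → y ≠ v → y ≠ b → y ≠ w → f v y = 0 → False := by
    clear ha hb hab hca hcb hea heb N0 ab ac ae bc be all sa sb wa wb
    intro a b N hab hbw wb y ⟨y1, y2⟩ y3 y4 y5 y6 y7
    obtain ⟨ha, hb, -, -, ab, ac, ae, bc, be, -, all⟩ := N
    have := H.path c y a b w
    have := p v b c
    have := p v b a
    have := p v e a
    have := ne a y
    have := ne c y
    grind
  have a0 : ∀ y, f a y ≠ 0 → y ≠ v → y ≠ b → f v y = 0 := by
    intro y h1 h2 h3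
    by_contra h
    have := all y h
    have := ne a y
    grind
  have b0 : ∀ y, f b y ≠ 0 → y ≠ v → y ≠ a → f v y = 0 := by
    intro y h1 h2 h3
    by_contra h
    have := all y h
    have := ne b y
    grind
  -- The path `a b y' c y` would carry the colours of `vc`, `ve`, `va`, `vb`.
  have both : ∀ y y', f y a = f v e ∧ f y c = f v b → f y' b = f v e ∧ f y' c = f v a →
      f v y = 0 → f v y' = 0 → y ≠ v → y' ≠ v → False := by
    intro y y' ⟨h1, h2⟩ ⟨h3, h4⟩ h5 h6 h7 h8
    have := H.path a b y' c y
    have := p y a b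
    have := p v c a
    have := p v c b
    have := p v e b
    have := ne y a
    grind
  have za : ∀ y, f a y ≠ 0 → y ≠ v → y ≠ b → y = w := by
    intro y h1 h2 h3
    by_contra h4
    have k := sa y h1 h2 h3 h4
    obtain ⟨y', y1, y2, y3⟩ := not_degLeTwo (nd b hb be) v a
    by_cases hy : y' = w
    · subst hy
      exact far a b N0 hab y1 (wb (by rwa [s])) y k h1 h2 h3 h4 (a0 y h1 h2 h3)
    · exact both y y' k (sb y' y1 y2 y3 hy) (a0 y h1 h2 h3) (b0 y' y1 y2 y3) h2 y2
  have zb : ∀ y, f b y ≠ 0 → y ≠ v → y ≠ a → y = w := by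
    intro y h1 h2 h3
    by_contra h4
    have k := sb y h1 h2 h3 h4
    obtain ⟨y', y1, y2, y3⟩ := not_degLeTwo (nd a ha ae) v b
    by_cases hy : y' = w
    · subst hy
      exact far b a N0.swap₁₂ (by rw [s, hab]) y1 (wa (by rwa [s])) y k h1 h2 h3 h4
        (b0 y h1 h2 h3)
    · exact both y' y (sa y' y1 y2 y3 hy) k (a0 y' y1 y2 y3) (b0 y h1 h2 h3) y2 h2
  obtain ⟨z, z1, z2, z3⟩ := not_degLeTwo (nd c hc ce) v w
  have z0 : f v z = 0 := by
    by_contra h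
    have := all z h
    have := ne c z
    grind
  obtain ⟨u, u1, u2⟩ := H.exists_adj_ne z c
  have uz : f u z ≠ 0 := by rwa [s]
  have := all u (nt c z hc z1 z2 z0 u u1)
  have := ew z
  have := za z
  have := zb z
  grind

end RainbowPlanar

/-! ### Poor vertices: independent neighbourhood, no tails. -/

namespace RainbowPlanar

variable {V : Type*} {f : V → V → ℕ} {v a b c e : V}

theorem NbrsFour.relabel (N : NbrsFour f v a b c e) {p q r : V} (hp : f v p ≠ 0) (hq : f v q ≠ 0)
    (hr : f v r ≠ 0) (pq : p ≠ q) (pr : p ≠ r) (qr : q ≠ r) : ∃ t, NbrsFour f v p q r t := by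
  have h1 : ∃ b c e, NbrsFour f v p b c e := by
    rcases N.all p hp with rfl | rfl | rfl | rfl
    · exact ⟨_, _, _, N⟩
    · exact ⟨_, _, _, N.swap₁₂⟩
    · exact ⟨_, _, _, N.swap₂₃.swap₁₂⟩
    · exact ⟨_, _, _, N.swap₃₄.swap₂₃.swap₁₂⟩
  obtain ⟨b, c, e, N⟩ := h1
  have h2 : ∃ c e, NbrsFour f v p q c e := by
    rcases N.all q hq with rfl | rfl | rfl | rfl
    · exact (pq rfl).elim
    · exact ⟨_, _, N⟩
    · exact ⟨_, _, N.swap₂₃⟩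
    · exact ⟨_, _, N.swap₃₄.swap₂₃⟩
  obtain ⟨c, e, N⟩ := h2
  rcases N.all r hr with rfl | rfl | rfl | rfl
  · exact (pr rfl).elim
  · exact (qr rfl).elim
  · exact ⟨_, N⟩
  · exact ⟨_, N.swap₃₄⟩

/-- Without cherries an edge `pq` is isolated in the neighbourhood. A remaining neighbour reached in
a colour other than that of `pq` has degree two; two of these contradict `Poor`, and otherwise
`poor_no_isolated` applies. -/
theorem Reduced.poor_indep (H : Reduced f) (N : NbrsFour f v a b c e) (P : Poor f v) :
    ∀ p q, f v p ≠ 0 → f v q ≠ 0 → f p q = 0 := by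
  have s := H.symm
  have hX : ∀ a b c, f v a ≠ 0 → f v b ≠ 0 → f v c ≠ 0 → f a b ≠ 0 → f a c ≠ 0 → b ≠ c →
      ¬ (f a b = f v c ∧ f a c = f v b) := by
    rintro p q r hp hq hr pq pr qr ⟨h1, h2⟩
    obtain ⟨t, N'⟩ := N.relabel hp hq hr (H.ne pq) (H.ne pr) qr
    exact H.poor_no_exceptional N' P h1 h2
  have hC : ∀ a b c, f v a ≠ 0 → f v b ≠ 0 → f v c ≠ 0 → f a b ≠ 0 → b ≠ c → f a c = 0 := by
    intro p q r hp hq hr pq qr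
    by_contra pr
    obtain ⟨t, N'⟩ := N.relabel hp hq hr (H.ne pq) (H.ne pr) qr
    rcases H.cherry hp hq hr N'.he pq pr qr N'.ae.symm N'.be.symm N'.ce.symm
      (hX p q r hp hq hr pq pr qr) with h | h
    · exact H.poor_no_cherry N' P pq pr hX h
    · exact H.poor_no_cherry N'.swap₂₃ P pr pq hX h
  intro p q hp hq
  by_contra pq
  have : ∃ r, f v r ≠ 0 ∧ p ≠ r ∧ q ≠ r := by
    obtain ⟨r, h1, h2, h3, -⟩ := N.degGeFour p q q
    exact ⟨r, h1, h2.symm, h3.symm⟩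
  obtain ⟨r, hr, pr, qr⟩ := this
  obtain ⟨t, N'⟩ := N.relabel hp hq hr (H.ne pq) pr qr
  have ht := N'.he
  have e1 := hC p q r hp hq hr pq qr
  have e2 := hC p q t hp hq ht pq N'.be
  have e3 := hC q p r hq hp hr (by rwa [s]) pr
  have e4 := hC q p t hq hp ht (by rwa [s]) N'.ae
  have s' : ∀ {a b}, f a b = 0 → f b a = 0 := fun {a b} h => by rwa [s]
  have hd : ∀ j, f v j ≠ 0 → j ≠ p → j ≠ q → f v j ≠ f p q → DegLeTwo f j := by
    intro j hj jp jq hc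
    obtain ⟨w, w1, w2⟩ := H.exists_adj_ne j v
    have o : ∀ w, f j w ≠ 0 → w ≠ v → f j w = f p q := by
      intro w h1 h2
      exact H.outer_colour hp hq hj pq jp jq hc h1 h2
        (by rintro rfl; exact h1 (s' (hC w q j hp hq hj pq jq.symm)))
        (by rintro rfl; exact h1 (s' (hC w p j hq hp hj (by rwa [s]) jp.symm)))
    refine ⟨v, w, fun z hz => ?_⟩
    by_contra! h
    exact h.2 (H.proper j z w hz (by rw [o z hz h.1, o w w1 w2]))
  by_cases h1 : f v r = f p q
  · exact H.poor_no_isolated N' P h1.symm (s' e1) (s' e3) (s' e2) (s' e4)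
  by_cases h2 : f v t = f p q
  · exact H.poor_no_isolated N'.swap₃₄ P h2.symm (s' e2) (s' e4) (s' e1) (s' e3)
  exact N'.ce (P.nbr r t hr ht (hd r hr pr.symm qr.symm h1) (hd t ht N'.ae.symm N'.be.symm h2))

/-- The tail restricts `b` and `e` to outer edges coloured like `va` and `vc`, and degree at least
three makes both occur. The ends are the same two vertices `A`, `C` for `b` and for `e`, and `c` is
joined to both. The third neighbour `x` of `a` needs another neighbour; since `xc` is no edge this
is `b` or `e`, so `x` is `A` or `C`, which are adjacent to `c`. -/
theorem Reduced.poor_no_tail_of_colour (H : Reduced f) (N : NbrsFour f v a b c e)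
    (P : Poor f v) {t y : V} (T : IsTail f v a t y) (hc : f a t = f v c) : False := by
  have s := H.symm
  have p := H.proper
  have ne := fun a b => H.ne (a := a) (b := b)
  have hv := N.degGeFour
  have ind := H.poor_indep N P
  obtain ⟨x, xv, xt, hax, a3⟩ := H.tail_deg hv T
  have N0 := N
  have T0 := T
  obtain ⟨-, h2, h3, h4, h5, h6, h7, h8⟩ := T
  have hxa : f x a ≠ 0 := by rwa [s]
  have D2 : ∀ u w, f v u ≠ 0 → f u w ≠ 0 → w ≠ v → f v w = 0 := by
    intro u w h1 h2 h3
    by_contra h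
    exact h2 (ind u w h1 h)
  have nt : ∀ u w, f v u ≠ 0 → f u w ≠ 0 → w ≠ v → w ≠ t → ∀ z, f w z ≠ 0 → f v z ≠ 0 := by
    intro u w h1 h2 h3 h4
    rcases H.nontail_or_tail hv h1 h2 h3 (D2 u w h1 h2 h3) with h' | ⟨y, hy⟩
    · exact h'
    · exact (h4 (P.tail _ _ _ _ _ _ hy T0)).elim
  have tn : ∀ u, f v u ≠ 0 → f u t ≠ 0 → u = a := by
    intro u h1 h2
    have := h8 u (by rwa [s])
    grind
  have nd : ∀ u, f v u ≠ 0 → ¬ DegLeTwo f u := fun u hu h => P.nbr_tail u a t y hu h T0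
  have out : ∀ j k, NbrsFour f v a j c k → ∃ A C, f j A = f v a ∧ f j C = f v c ∧
      A ≠ v ∧ C ≠ v ∧ ∀ w, f j w ≠ 0 → w ≠ v → w = A ∨ w = C := by
    intro j k N
    obtain ⟨ha, hj, hc', hk, aj, ac, ak, jc, jk, ck, all⟩ := N
    have o : ∀ w, f j w ≠ 0 → w ≠ v → f j w = f v a ∨ f j w = f v c := by
      intro w h1' h2'
      have wt : t ≠ w := by
        rintro rfl
        exact aj (tn j hj h1').symm
      have := H.two_outer ha hj aj h2 h1' h3 h2' wt (by rintro rfl; exact hj h4)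
        (by rintro rfl; exact ha (D2 j w hj h1' h2'))
      have := p v c j
      grind
    obtain ⟨w, w1, w2⟩ := H.exists_adj_ne j v
    obtain ⟨w', w1', w2', ww⟩ := not_degLeTwo (nd j hj) v w
    have d : ∀ w w', f j w = f v a → f j w' = f v c → w ≠ v → w' ≠ v →
        ∃ A C, f j A = f v a ∧ f j C = f v c ∧ A ≠ v ∧ C ≠ v ∧
          ∀ w, f j w ≠ 0 → w ≠ v → w = A ∨ w = C := by
      intro w w' e1 e2 n1 n2
      refine ⟨w, w', e1, e2, n1, n2, fun z z1 z2 => ?_⟩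
      rcases o z z1 z2 with h | h
      · exact Or.inl (p j z w z1 (by rw [h, e1]))
      · exact Or.inr (p j z w' z1 (by rw [h, e2]))
    have := p j w w' w1
    rcases o w w1 w2 with h | h <;> rcases o w' w1' w2' with h' | h'
    · grind
    · exact d w w' h h' w2 w2'
    · exact d w' w h' h w2' w2
    · grind
  obtain ⟨A, C, hA, hC, Av, Cv, hb⟩ := out b e N
  obtain ⟨A', C', hA', hC', Av', Cv', he⟩ := out e b N.swap₃₄.swap₂₃.swap₃₄
  obtain ⟨ha0, hb0, hc0, he0, ab, ac, ae, bc, be, ce, all⟩ := N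
  have bA : f b A ≠ 0 := by omega
  have bC : f b C ≠ 0 := by omega
  have eA : f e A' ≠ 0 := by omega
  have eC : f e C' ≠ 0 := by omega
  have nN : ∀ {u w u'}, f v u ≠ 0 → f u w ≠ 0 → w ≠ v → f v u' ≠ 0 → w ≠ u' := by
    rintro u w u' h1 h2 h3 h4 rfl
    exact h4 (D2 u w h1 h2 h3)
  have pv := p v
  -- Otherwise `A b v e C'` carries the colours of the four edges at `v`.
  have AC : A = C' := by
    by_contra h
    have := H.two_outer hb0 he0 be bA eC Av Cv' h (nN hb0 bA Av he0) (nN he0 eC Cv' hb0)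
    have := pv a e
    have := pv c a
    have := pv c b
    grind
  have CA : C = A' := by
    by_contra h
    have := H.two_outer hb0 he0 be bC eA Cv Av' h (nN hb0 bC Cv he0) (nN he0 eA Av' hb0)
    have := pv a c
    have := pv c e
    have := pv a b
    grind
  subst AC CA
  have bt : ∀ u, f v u ≠ 0 → f x u ≠ 0 → u ≠ a → f x u = f v a ∨ f x u = f v c := by
    intro u hu hxu ua
    have := H.path y t a x u
    have y3 := fun h => H.tail_end hv T0 hu h
    have y4 := fun h => H.tail_end hv T0 ha0 h
    have y5 : y ≠ u := by
      rintro rfl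
      exact hu h7
    have tu : t ≠ u := by
      rintro rfl
      exact hu h4
    have := p a v x
    have := p x u a
    have yx : y ≠ x := by
      rintro rfl
      exact y4 hax
    have := ne v u
    grind
  have x0 := D2 a x ha0 hax xv
  have xN := nt a x ha0 hax xv xt
  have xc : f x c = 0 := by
    by_contra h
    have := bt c hc0 h ac.symm
    have := H.nontail_colours N0.swap₂₃ x0 xv hxa h
    have := p a x t
    have := p c x v
    have := pv b a
    have := pv b c
    have := pv e a
    have := pv e c
    have := ne x a
    have := p a v x
    grind
  have cz : ∀ z, f c z ≠ 0 → z ≠ v → z = A ∨ z = C := by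
    intro z h1 h2
    have zt : z ≠ t := by
      rintro rfl
      exact ac (tn c hc0 h1).symm
    obtain ⟨u, u1, u2⟩ := H.exists_adj_ne z c
    have uz : f u z ≠ 0 := by rwa [s]
    have := nt c z hc0 h1 h2 zt u u1
    have := all u this
    have := a3 z
    have := hb z
    have := he z
    have := s c z
    grind
  obtain ⟨z, z1, z2⟩ := H.exists_adj_ne c v
  obtain ⟨z', z1', z2', zz⟩ := not_degLeTwo (nd c hc0) v z
  have := cz z z1 z2
  have := cz z' z1' z2'
  obtain ⟨u, u1, u2⟩ := H.exists_adj_ne x a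
  have := all u (xN u u1)
  have := hb x
  have := he x
  have := s x b
  have := s x e
  have := s x c
  grind

/-- When `ut` has a colour not used at `v`, comparison with it forces every outer edge at `b` to
have the colour of `vu`. Then `b` has degree two, although a tail is present. -/
theorem Reduced.poor_no_tail (H : Reduced f) (N : NbrsFour f v a b c e) (P : Poor f v)
    {u t y : V} (T : IsTail f v u t y) : False := by
  have s := H.symm
  have p := H.proper
  have hu := T.1
  have ind := H.poor_indep N P
  have hv := N.degGeFour
  have hN : ∃ b c e, NbrsFour f v u b c e := by
    obtain ⟨q, q1, q2, -⟩ := hv u u u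
    obtain ⟨r, r1, r2, r3, -⟩ := hv u q q
    obtain ⟨e, h⟩ := N.relabel hu q1 r1 q2.symm r2.symm r3.symm
    exact ⟨q, r, e, h⟩
  clear N
  obtain ⟨b, c, e, N⟩ := hN
  by_cases h1 : f u t = f v b
  · exact H.poor_no_tail_of_colour N.swap₂₃ P T h1
  by_cases h2 : f u t = f v c
  · exact H.poor_no_tail_of_colour N P T h2
  by_cases h3 : f u t = f v e
  · exact H.poor_no_tail_of_colour N.swap₃₄ P T h3
  have N0 := N
  have T0 := T
  obtain ⟨ha, hb, hc, he, ab, ac, ae, bc, be, ce, all⟩ := N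
  obtain ⟨-, k2, k3, k4, k5, k6, k7, k8⟩ := T
  obtain ⟨w, w1, w2, w3⟩ := not_degLeTwo
    (fun h => P.nbr_tail b u t y hb h T0) v v
  obtain ⟨w', w1', w2', ww⟩ := not_degLeTwo
    (fun h => P.nbr_tail b u t y hb h T0) v w
  have key : ∀ w, f b w ≠ 0 → w ≠ v → f b w = f v u := by
    intro w w1 w2
    have w0 : f v w = 0 := by
      by_contra h
      exact w1 (ind b w hb h)
    have bw : f w b ≠ 0 := by rwa [s]
    have tw : t ≠ w := by
      rintro rfl
      have := k8 b bw
      grind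
    have o := H.two_outer ha hb ab k2 w1 k3 w2 tw (by rintro rfl; exact hb k4)
      (by rintro rfl; exact ha w0)
    rcases H.nontail_or_tail hv hb w1 w2 w0 with h' | ⟨y, hy⟩
    · obtain ⟨z, z1, z2⟩ := H.exists_adj_ne w b
      have := s b w
      rcases all z (h' z z1) with rfl | rfl | rfl | rfl
      · have := H.nontail_colours N0.swap₁₂ w0 w2 bw z1
        grind
      · exact (z2 rfl).elim
      · have := H.nontail_colours N0.swap₁₂.swap₂₃ w0 w2 bw z1
        grind
      · have := H.nontail_colours N0.swap₁₂.swap₂₃.swap₃₄.swap₂₃ w0 w2 bw z1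
        grind
    · exact (tw (P.tail _ _ _ _ _ _ T0 hy)).elim
  exact ww (p b w' w w1' (by rw [key w w1 w2, key w' w1' w2']))

end RainbowPlanar

/-! ### The closed set of eight vertices around a poor vertex. -/

namespace RainbowPlanar

/-- There is no `K₃,₃`, and no `K₃,₃` one of whose edges is replaced by a path of length three. -/
structure NoK33 {V : Type*} (f : V → V → ℕ) : Prop where
  plain : ∀ a b : Fin 3 → V, Function.Injective a → Function.Injective b →
    (∀ i j, f (a i) (b j) ≠ 0) → False
  subdivided : ∀ a b : Fin 3 → V, Function.Injective a → Function.Injective b →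
    (∀ i j, a i ≠ b j) → ∀ p q, p ≠ q → (∀ i, a i ≠ p) → (∀ i, a i ≠ q) → (∀ i, b i ≠ p) →
    (∀ i, b i ≠ q) → (∀ i j, (i, j) ≠ (0, 0) → f (a i) (b j) ≠ 0) → f (a 0) p ≠ 0 → f p q ≠ 0 →
    f q (b 0) ≠ 0 → False

/-- The edges from `x` to the neighbours of `v` are coloured by exchanging `a`, `b` and `c`, `e`. -/
def Paired {V : Type*} (f : V → V → ℕ) (v a b c e x : V) : Prop :=
  (f x a ≠ 0 → f x a = f v b) ∧ (f x b ≠ 0 → f x b = f v a) ∧ (f x c ≠ 0 → f x c = f v e) ∧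
    (f x e ≠ 0 → f x e = f v c)

variable {V : Type*} {f : V → V → ℕ} {v a b c e : V}

/-- Let distinct `x`, `z` use the same matching, with neighbours `u`, `t` among those of `v`.
Properness at `t` gives `u ≠ t`, and `two_outer` then makes `u` the partner of `t`. But `x` has two
such neighbours. -/
theorem RainbowFree.paired_unique (H : RainbowFree f) (N : NbrsFour f v a b c e)
    (two : ∀ x u, f v u ≠ 0 → f u x ≠ 0 → x ≠ v → f v x = 0 ∧ ∃ w, f v w ≠ 0 ∧ f x w ≠ 0 ∧ w ≠ u) :
    ∃ z, ∀ x u, f v u ≠ 0 → f u x ≠ 0 → x ≠ v → Paired f v a b c e x → x = z := by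
  by_cases hz : ∃ z, (∃ u, f v u ≠ 0 ∧ f u z ≠ 0) ∧ z ≠ v ∧ Paired f v a b c e z
  · obtain ⟨z, ⟨t, ht, tz⟩, zv, P⟩ := hz
    refine ⟨z, fun x u hu hx xv P' => ?_⟩
    by_contra xz
    have s := H.symm
    have p := H.proper
    obtain ⟨z0, t', ht', zt', tt⟩ := two z t ht tz zv
    obtain ⟨x0, u', hu', xu', uu⟩ := two x u hu hx xv
    have key : ∀ t u, f v t ≠ 0 → f t z ≠ 0 → f v u ≠ 0 → f u x ≠ 0 → t ≠ u →
        f t z = f u x ∨ f t z = f v u ∨ f u x = f v t := fun t u h1 h2 h3 h4 h5 =>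
      H.two_outer h1 h3 h5 h2 h4 zv xv (Ne.symm xz) (by rintro rfl; exact h3 z0)
        (by rintro rfl; exact h1 x0)
    have k1 := key t u ht tz hu hx
    have k2 := key t' u ht' (by rwa [s]) hu hx
    have k3 := key t u' ht tz hu' (by rwa [s])
    have k4 := key t' u' ht' (by rwa [s]) hu' (by rwa [s])
    have e1 := s t z
    have e2 := s t' z
    have e3 := s u x
    have e4 := s u' x
    have pv := p v
    obtain ⟨ha, hb, hc, he, ab, ac, ae, bc, be, ce, all⟩ := N
    have q1 := pv a b ha
    have q2 := pv a c ha
    have q3 := pv a e ha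
    have q4 := pv b c hb
    have q5 := pv b e hb
    have q6 := pv c e hc
    clear pv
    have j1 := p t z x
    have j2 := p t' z x
    unfold Paired at P P'
    clear p key two s
    have a1 := all t ht
    have a2 := all t' ht'
    have a3 := all u hu
    have a4 := all u' hu'
    clear all
    rcases a1 with rfl | rfl | rfl | rfl <;> rcases a2 with rfl | rfl | rfl | rfl <;>
      first | exact absurd rfl tt | skip
    all_goals
      rcases a3 with rfl | rfl | rfl | rfl <;> rcases a4 with rfl | rfl | rfl | rfl <;>
        first | exact absurd rfl uu | grind
  · push Not at hz
    -- Here `v` is only a default; `poor_structure` later shows that it does not occur.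
    exact ⟨v, fun x u hu hx xv P => (hz x ⟨u, hu, hx⟩ xv P).elim⟩

/-- The six pairs of neighbours of `v` are compared by `nontail_colours`: an edge from `x` to one
neighbour has the colour at `v` of another, and these assignments fit into one perfect matching. The
two given neighbours ensure that some pair applies. -/
theorem RainbowFree.paired_or (H : RainbowFree f) (N : NbrsFour f v a b c e) {x u w : V}
    (hu : f v u ≠ 0) (hw : f v w ≠ 0) (uw : w ≠ u) (xu : f x u ≠ 0) (xw : f x w ≠ 0)
    (xv : x ≠ v) (x0 : f v x = 0) :
    Paired f v a b c e x ∨ Paired f v a c b e x ∨ Paired f v a e b c x := by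
  have c1 := H.nontail_colours N x0 xv
  have c2 := H.nontail_colours N.swap₂₃ x0 xv
  have c3 := H.nontail_colours N.swap₃₄.swap₂₃ x0 xv
  have c4 := H.nontail_colours N.swap₁₂.swap₂₃ x0 xv
  have c5 := H.nontail_colours N.swap₁₂.swap₃₄.swap₂₃ x0 xv
  have c6 := H.nontail_colours N.swap₂₃.swap₁₂.swap₃₄.swap₂₃ x0 xv
  have pv := H.proper v
  have px := H.proper x
  obtain ⟨ha, hb, hc, he, ab, ac, ae, bc, be, ce, all⟩ := N
  have q1 := pv a b ha
  have q2 := pv a c ha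
  have q3 := pv a e ha
  have q4 := pv b c hb
  have q5 := pv b e hb
  have q6 := pv c e hc
  have a1 := all u hu
  have a2 := all w hw
  clear pv px all
  unfold Paired
  by_cases h1 : f x a = 0 <;> by_cases h2 : f x b = 0 <;> by_cases h3 : f x c = 0 <;>
    by_cases h4 : f x e = 0 <;> grind

/-- The structure around a poor vertex of degree four. -/
theorem Reduced.poor_structure (H : Reduced f) (N : NbrsFour f v a b c e) (P : Poor f v)
    (K : NoK33 f) : ∃ x y z, x ≠ y ∧ x ≠ z ∧ y ≠ z ∧ x ≠ v ∧ y ≠ v ∧ z ≠ v ∧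
      f v x = 0 ∧ f v y = 0 ∧ f v z = 0 ∧
      (∀ u, f x u ≠ 0 ∨ f y u ≠ 0 ∨ f z u ≠ 0 → f v u ≠ 0) ∧
      ∀ u, f v u ≠ 0 → ∀ w, f u w ≠ 0 → w = v ∨ w = x ∨ w = y ∨ w = z := by
  have s := H.symm
  have ind := H.poor_indep N P
  have hv := N.degGeFour
  have D : ∀ u x, f v u ≠ 0 → f u x ≠ 0 → x ≠ v → f v x = 0 ∧ ∀ z, f x z ≠ 0 → f v z ≠ 0 := by
    intro u x h1 h2 h3
    have x0 : f v x = 0 := by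
      by_contra h
      exact h2 (ind u x h1 h)
    refine ⟨x0, ?_⟩
    rcases H.nontail_or_tail hv h1 h2 h3 x0 with h' | ⟨y, hy⟩
    · exact h'
    · exact (H.poor_no_tail N P hy).elim
  have two : ∀ x u, f v u ≠ 0 → f u x ≠ 0 → x ≠ v →
      f v x = 0 ∧ ∃ w, f v w ≠ 0 ∧ f x w ≠ 0 ∧ w ≠ u := by
    intro x u h1 h2 h3
    obtain ⟨h4, h5⟩ := D u x h1 h2 h3
    obtain ⟨w, h6, h7⟩ := H.exists_adj_ne x u
    exact ⟨h4, w, h5 w h6, h6, h7⟩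
  obtain ⟨x, hx⟩ := H.paired_unique N two
  obtain ⟨y, hy⟩ := H.paired_unique N.swap₂₃ two
  obtain ⟨z, hz⟩ := H.paired_unique N.swap₃₄.swap₂₃ two
  have all : ∀ u, f v u ≠ 0 → ∀ w, f u w ≠ 0 → w = v ∨ w = x ∨ w = y ∨ w = z := by
    intro u hu w hw
    by_cases wv : w = v
    · exact Or.inl wv
    obtain ⟨w0, t, ht, wt, tu⟩ := two w u hu hw wv
    rcases H.paired_or N hu ht tu (by rwa [s]) wt wv w0 with h | h | h
    · exact Or.inr (Or.inl (hx w u hu hw wv h))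
    · exact Or.inr (Or.inr (Or.inl (hy w u hu hw wv h)))
    · exact Or.inr (Or.inr (Or.inr (hz w u hu hw wv h)))
  -- At most one neighbour of `v` has degree two, so the other three would form a `K₃,₃` with `v`,
  -- `x`, `y`.
  have K2 : ∀ x y, ¬ ∀ u, f v u ≠ 0 → ∀ w, f u w ≠ 0 → w = v ∨ w = x ∨ w = y := by
    intro x y hall
    have nd : ∀ u, f v u ≠ 0 → ¬ DegLeTwo f u → f u x ≠ 0 ∧ f u y ≠ 0 ∧ x ≠ y ∧ x ≠ v ∧ y ≠ v := by
      intro u hu h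
      obtain ⟨w, w1, w2, w3⟩ := not_degLeTwo h v v
      obtain ⟨w', w1', w2', w3'⟩ := not_degLeTwo h v w
      have := hall u hu w w1
      have := hall u hu w' w1'
      grind
    have fin : ∀ a b c e, NbrsFour f v a b c e → ¬ DegLeTwo f a → ¬ DegLeTwo f b →
        ¬ DegLeTwo f c → False := by
      intro a b c e N da db dc
      obtain ⟨a1, a2, xy, xv, yv⟩ := nd a N.ha da
      obtain ⟨b1, b2, -⟩ := nd b N.hb db
      obtain ⟨c1, c2, -⟩ := nd c N.hc dc
      have ab := N.ab
      have ac := N.ac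
      have bc := N.bc
      refine K.plain ![a, b, c] ![v, x, y] ?_ ?_ ?_
      · intro i j; fin_cases i <;> fin_cases j <;> simp <;> grind
      · intro i j; fin_cases i <;> fin_cases j <;> simp <;> grind
      · have h1 := N.ha
        have h2 := N.hb
        have h3 := N.hc
        rw [s] at h1 h2 h3
        intro i j; fin_cases i <;> fin_cases j <;> simpa
    have one := fun p q hp hq (pq : p ≠ q) h1 h2 => pq (P.nbr p q hp hq h1 h2)
    by_cases da : DegLeTwo f a
    · exact fin b c e a N.swap₁₂.swap₂₃.swap₃₄ (fun h => one _ _ N.ha N.hb N.ab da h)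
        (fun h => one _ _ N.ha N.hc N.ac da h) (fun h => one _ _ N.ha N.he N.ae da h)
    by_cases db : DegLeTwo f b
    · exact fin a c e b N.swap₂₃.swap₃₄ da (fun h => one _ _ N.hb N.hc N.bc db h)
        (fun h => one _ _ N.hb N.he N.be db h)
    by_cases dc : DegLeTwo f c
    · exact fin a b e c N.swap₃₄ da db (fun h => one _ _ N.hc N.he N.ce dc h)
    · exact fin a b c e N da db dc
  -- If two of the three vertices coincided, or one were a default or unattached to the
  -- neighbourhood, two vertices would suffice, contrary to `K2`.
  have gen : ∀ x y z, (∀ u, f v u ≠ 0 → ∀ w, f u w ≠ 0 → w = v ∨ w = x ∨ w = y ∨ w = z) →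
      x ≠ y ∧ x ≠ v ∧ f v x = 0 ∧ ∀ u, f x u ≠ 0 → f v u ≠ 0 := by
    intro x y z hall
    refine ⟨?_, ?_, ?_⟩
    · rintro rfl
      exact K2 x z fun u hu w hw => by have := hall u hu w hw; tauto
    · rintro rfl
      exact K2 y z fun u hu w hw => by have := hall u hu w hw; tauto
    · by_contra hc
      refine K2 y z fun u hu w hw => ?_
      rcases hall u hu w hw with h | rfl | h | h
      · exact Or.inl h
      · by_cases wv : w = v
        · exact Or.inl wv
        · exact (hc (D u w hu hw wv)).elim
      · tauto
      · tauto
  obtain ⟨x1, x2, x3, x4⟩ := gen x y z all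
  obtain ⟨y1, y2, y3, y4⟩ := gen y z x fun u hu w hw => by have := all u hu w hw; tauto
  obtain ⟨z1, z2, z3, z4⟩ := gen z x y fun u hu w hw => by have := all u hu w hw; tauto
  refine ⟨x, y, z, x1, z1.symm, y1, x2, y2, z2, x3, y3, z3, fun u hu => ?_, all⟩
  rcases hu with h | h | h
  · exact x4 u h
  · exact y4 u h
  · exact z4 u h

end RainbowPlanar

/-! ### Deletion and discharging. -/

namespace RainbowPlanar

open Finset

/-- The number of neighbours of `a`. -/
def deg {V : Type*} [Fintype V] (f : V → V → ℕ) (a : V) : ℕ := #{b | f a b ≠ 0}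

theorem RainbowFree.comap {V W : Type*} {f : V → V → ℕ} (H : RainbowFree f) {g : W → V}
    (hg : Function.Injective g) : RainbowFree fun a b => f (g a) (g b) where
  symm _ _ := H.symm _ _
  irrefl _ := H.irrefl _
  proper _ _ _ h1 h2 := hg (H.proper _ _ _ h1 h2)
  not_rainbow _ _ _ _ _ h1 h2 h3 h4 n1 n2 n3 n4 n5 n6 :=
    H.not_rainbow _ _ _ _ _ h1 h2 h3 h4 (hg.ne n1) (hg.ne n2) (hg.ne n3) (hg.ne n4) (hg.ne n5)
      (hg.ne n6)

theorem NoK33.comap {V W : Type*} {f : V → V → ℕ} (H : NoK33 f) {g : W → V}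
    (hg : Function.Injective g) : NoK33 fun a b => f (g a) (g b) where
  plain a b ha hb h := H.plain (g ∘ a) (g ∘ b) (hg.comp ha) (hg.comp hb) h
  subdivided a b ha hb hab p q pq h1 h2 h3 h4 h5 h6 h7 h8 :=
    H.subdivided (g ∘ a) (g ∘ b) (hg.comp ha) (hg.comp hb) (fun i j => hg.ne (hab i j)) (g p) (g q)
      (hg.ne pq) (fun i => hg.ne (h1 i)) (fun i => hg.ne (h2 i)) (fun i => hg.ne (h3 i))
      (fun i => hg.ne (h4 i)) h5 h6 h7 h8

variable {V : Type*} [Fintype V] {f : V → V → ℕ}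

theorem deg_eq_sum (f : V → V → ℕ) (a : V) : deg f a = ∑ b, if f a b ≠ 0 then 1 else 0 := by
  rw [deg, card_filter]

theorem deg_le_card (f : V → V → ℕ) (a : V) (s : Finset V) (h : ∀ b, f a b ≠ 0 → b ∈ s) :
    deg f a ≤ #s :=
  card_le_card fun b hb => h b (by simpa using hb)

theorem exists_notMem_of_lt_deg {a : V} {s : Finset V} (h : #s < deg f a) :
    ∃ b, f a b ≠ 0 ∧ b ∉ s := by
  obtain ⟨b, h1, h2⟩ := exists_mem_notMem_of_card_lt_card h
  exact ⟨b, by simpa using h1, h2⟩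

theorem DegLeTwo.deg_le [DecidableEq V] {x : V} (h : DegLeTwo f x) : deg f x ≤ 2 := by
  obtain ⟨a, b, h⟩ := h
  exact (deg_le_card f x {a, b} (by simpa using h)).trans card_le_two

/-- Deleting a set `S` of vertices. -/
theorem sum_deg_le_of_delete [DecidableEq V] (hs : ∀ a b, f a b = f b a) (S : Finset V)
    (hS : 2 * ∑ a ∈ S, deg f a ≤ 3 * #S + ∑ a ∈ S, #{b ∈ S | f a b ≠ 0})
    (hI : ∑ a : {x // x ∉ S}, deg (fun a b : {x // x ∉ S} => f a b) a ≤
      3 * Fintype.card {x // x ∉ S}) :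
    ∑ a, deg f a ≤ 3 * Fintype.card V := by
  set w : V → V → ℕ := fun a b => if f a b ≠ 0 then 1 else 0 with hw
  have e1 : ∀ a, deg f a = ∑ b ∈ S, w a b + ∑ b ∈ Sᶜ, w a b := fun a => by
    rw [deg_eq_sum, sum_add_sum_compl]
  have e2 : ∑ a, deg f a = ∑ a ∈ S, deg f a + ∑ a ∈ Sᶜ, deg f a := (sum_add_sum_compl _ _).symm
  have e3 : ∑ a ∈ S, #{b ∈ S | f a b ≠ 0} = ∑ a ∈ S, ∑ b ∈ S, w a b := by
    simp only [card_filter, hw]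
  have e4 : ∑ a ∈ Sᶜ, ∑ b ∈ S, w a b = ∑ a ∈ S, ∑ b ∈ Sᶜ, w a b := by
    rw [sum_comm]
    refine sum_congr rfl fun a _ => sum_congr rfl fun b _ => ?_
    simp only [hw, hs]
  have e5 : ∑ a : {x // x ∉ S}, deg (fun a b : {x // x ∉ S} => f a b) a =
      ∑ a ∈ Sᶜ, ∑ b ∈ Sᶜ, w a b := by
    rw [sum_subtype Sᶜ (p := fun x => x ∉ S) (by simp)]
    refine sum_congr rfl fun a _ => ?_
    rw [deg_eq_sum, sum_subtype Sᶜ (p := fun x => x ∉ S) (by simp)]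
  have e6 : Fintype.card V = #S + Fintype.card {x // x ∉ S} := by
    rw [Fintype.card_subtype_compl, Fintype.card_coe]
    have := card_le_univ S
    omega
  have e7 : ∑ a ∈ S, deg f a = ∑ a ∈ S, ∑ b ∈ S, w a b + ∑ a ∈ S, ∑ b ∈ Sᶜ, w a b := by
    rw [← sum_add_distrib]
    exact sum_congr rfl fun a _ => e1 a
  have e8 : ∑ a ∈ Sᶜ, deg f a = ∑ a ∈ Sᶜ, ∑ b ∈ S, w a b + ∑ a ∈ Sᶜ, ∑ b ∈ Sᶜ, w a b := by
    rw [← sum_add_distrib]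
    exact sum_congr rfl fun a _ => e1 a
  omega

open Classical in
/-- The pairs `(x, y)` of adjacent vertices with `x` of degree two such that `y = v`, or `x` is a
tail of `v` reached through `y`. -/
noncomputable def charges (f : V → V → ℕ) (v : V) : Finset (V × V) :=
  {d | DegLeTwo f d.1 ∧ f d.1 d.2 ≠ 0 ∧ (d.2 = v ∨ deg f d.2 ≤ 3 ∧ ∃ z, IsTail f v d.2 d.1 z)}

/-- The bound three on the degree of the middle vertex separates the two kinds of pairs. For two
tails with the same pair `(x, y)`, the edge from `x` to its other neighbour has the colours of both
`vy` and `v'y`, so `v = v'`. -/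
theorem RainbowFree.charges_disjoint (H : RainbowFree f) {v v' : V} (hv : 4 ≤ deg f v)
    (hv' : 4 ≤ deg f v') (vv : v ≠ v') : Disjoint (charges f v) (charges f v') := by
  rw [disjoint_left]
  rintro ⟨x, y⟩ h h'
  simp only [charges, mem_filter, mem_univ, true_and] at h h'
  obtain ⟨-, h1, h2⟩ := h
  obtain ⟨-, -, h2'⟩ := h'
  rcases h2 with rfl | ⟨h2, z, t⟩ <;> rcases h2' with rfl | ⟨h2', z', t'⟩
  · exact vv rfl
  · omega
  · omega
  · obtain ⟨a1, a2, -, -, a5, a6, -, -⟩ := t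
    obtain ⟨b1, -, -, -, b5, b6, -, b8⟩ := t'
    have : z = z' := by
      rcases b8 z (by omega) with h | h
      · exact (a6 h).elim
      · exact h
    subst this
    exact vv (H.proper y v v' (by rwa [H.symm]) (by rw [H.symm, ← a5, b5, H.symm]))

/-- A vertex of degree at most two occurs first in at most two pairs, and its doubled degree falls
at least two short of six. Disjointness of the charges lets these deficits pay all the excesses. -/
theorem sum_deg_le_of_charges (H : RainbowFree f)
    (h : ∀ v, 4 ≤ deg f v → 2 * deg f v ≤ 6 + #(charges f v)) :
    ∑ a, deg f a ≤ 3 * Fintype.card V := by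
  classical
  set B : Finset V := {v | 4 ≤ deg f v} with hB
  set D : Finset V := {v | deg f v ≤ 2} with hD
  have h1 : ∑ v ∈ B, #(charges f v) ≤ 2 * #D := by
    rw [← card_biUnion]
    · calc #(B.biUnion (charges f)) ≤ #(D.sigma fun x => {y | f x y ≠ 0}) := by
            refine card_le_card_of_injOn (fun d => ⟨d.1, d.2⟩) ?_ ?_
            · rintro ⟨x, y⟩ hd
              simp only [mem_coe, mem_biUnion, charges, mem_filter, mem_univ, true_and] at hd
              obtain ⟨v, -, h1, h2, -⟩ := hd
              simp [hD, h1.deg_le, h2]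
            · rintro ⟨x, y⟩ - ⟨x', y'⟩ - hd
              simpa using hd
        _ = ∑ x ∈ D, deg f x := by rw [card_sigma]; rfl
        _ ≤ ∑ x ∈ D, 2 := sum_le_sum fun x hx => by simpa [hD] using hx
        _ = 2 * #D := by rw [sum_const, smul_eq_mul, mul_comm]
    · intro v hv v' hv' vv
      simp only [hB, mem_coe, mem_filter, mem_univ, true_and] at hv hv'
      exact H.charges_disjoint hv hv' vv
  have h2 : ∑ v, (2 * deg f v + if deg f v ≤ 2 then 2 else 0) ≤
      ∑ v, (6 + if 4 ≤ deg f v then #(charges f v) else 0) := by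
    refine sum_le_sum fun v _ => ?_
    have := h v
    split_ifs <;> omega
  have h3 : ∑ v : V, (if deg f v ≤ 2 then 2 else 0) = 2 * #D := by
    rw [← sum_filter, sum_const, smul_eq_mul, mul_comm]
  rw [sum_add_distrib, sum_add_distrib, ← mul_sum, h3, ← sum_filter, sum_const, card_univ,
    smul_eq_mul] at h2
  change 2 * _ + _ ≤ _ * _ + ∑ v ∈ B, #(charges f v) at h2
  omega

theorem degGeFour_of_deg [DecidableEq V] {v : V} (h : 4 ≤ deg f v) : DegGeFour f v := by
  intro a b c
  obtain ⟨u, h1, h2⟩ := exists_notMem_of_lt_deg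
    (lt_of_le_of_lt (card_le_three (a := a) (b := b) (c := c)) (by omega : 3 < deg f v))
  simp only [mem_insert, mem_singleton, not_or] at h2
  exact ⟨u, h1, h2⟩

theorem degGeFive_of_deg [DecidableEq V] {v : V} (h : 5 ≤ deg f v) : DegGeFive f v := by
  intro a b c d
  obtain ⟨u, h1, h2⟩ := exists_notMem_of_lt_deg
    (lt_of_le_of_lt (card_le_four (a := a) (b := b) (c := c) (d := d)) (by omega : 4 < deg f v))
  simp only [mem_insert, mem_singleton, not_or] at h2
  exact ⟨u, h1, h2⟩

theorem exists_nbrsFour [DecidableEq V] {v : V} (h : deg f v = 4) :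
    ∃ a b c e, NbrsFour f v a b c e := by
  rw [deg, card_eq_succ] at h
  obtain ⟨a, s, h1, h2, h3⟩ := h
  obtain ⟨b, c, e, bc, be, ce, rfl⟩ := card_eq_three.1 h3
  have key : ∀ u, f v u ≠ 0 ↔ u = a ∨ u = b ∨ u = c ∨ u = e := by
    intro u
    have : u ∈ insert a ({b, c, e} : Finset V) ↔ f v u ≠ 0 := by rw [h2]; simp
    rw [← this]
    simp
  simp only [mem_insert, mem_singleton, not_or] at h1
  exact ⟨a, b, c, e, (key a).2 (by simp), (key b).2 (by simp), (key c).2 (by simp),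
    (key e).2 (by simp), h1.1, h1.2.1, h1.2.2, bc, be, ce, fun u hu => (key u).1 hu⟩

theorem Reduced.mem_charges_of_nbr (H : Reduced f) {v x : V} (h1 : f v x ≠ 0)
    (h2 : DegLeTwo f x) : (x, v) ∈ charges f v := by
  simp only [charges, mem_filter, mem_univ, true_and]
  exact ⟨h2, by rwa [H.symm], Or.inl trivial⟩

theorem Reduced.mem_charges_of_tail [DecidableEq V] (H : Reduced f) {v u x y : V}
    (hv : DegGeFour f v) (T : IsTail f v u x y) : (x, u) ∈ charges f v := by
  simp only [charges, mem_filter, mem_univ, true_and]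
  refine ⟨T.degLeTwo, by rw [H.symm]; exact T.2.1, Or.inr ⟨?_, y, T⟩⟩
  obtain ⟨w, -, -, -, hw⟩ := H.tail_deg hv T
  exact (deg_le_card f u {v, x, w} (by simpa using hw)).trans card_le_three

/-- A vertex of degree at least four is charged enough, or is poor of degree four. -/
theorem Reduced.charged_or_poor [DecidableEq V] (H : Reduced f) {v : V} (hv : 4 ≤ deg f v) :
    2 * deg f v ≤ 6 + #(charges f v) ∨ deg f v = 4 ∧ Poor f v := by
  by_cases h5 : 5 ≤ deg f v
  · left
    obtain ⟨a, b, c, m, m', hb, hc, hm, hm', bc, bm, bm', cm, cm', mm, d1, d2, d3, d4, all⟩ :=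
      H.five (degGeFive_of_deg h5)
    have : deg f v ≤ 5 :=
      (deg_le_card f v {a, b, c, m, m'} (by simpa using all)).trans card_le_five
    have : #({(b, v), (c, v), (m, v), (m', v)} : Finset (V × V)) ≤ #(charges f v) := by
      refine card_le_card fun d hd => ?_
      simp only [mem_insert, mem_singleton] at hd
      rcases hd with rfl | rfl | rfl | rfl
      · exact H.mem_charges_of_nbr hb d1
      · exact H.mem_charges_of_nbr hc d2
      · exact H.mem_charges_of_nbr hm d3
      · exact H.mem_charges_of_nbr hm' d4
    rw [card_eq_of_equiv_fin (n := 4)] at this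
    · omega
    · refine Finset.equivFinOfCardEq ?_
      rw [card_insert_of_notMem, card_insert_of_notMem, card_insert_of_notMem, card_singleton] <;>
        simp [*]
  -- Degree four needs `2 * 4 - 6 = 2` charges; having at most one of them is what yields `Poor`.
  · by_cases hT : 2 ≤ #(charges f v)
    · left
      omega
    · right
      refine ⟨by omega, ?_⟩
      have h1 := card_le_one.1 (by omega : #(charges f v) ≤ 1)
      have hv4 := degGeFour_of_deg hv
      refine ⟨fun x y hx hy dx dy => ?_, fun z u x y hz dz T => ?_,
        fun u x y u' x' y' T T' => ?_⟩
      · exact congrArg Prod.fst (h1 _ (H.mem_charges_of_nbr hx dx) _ (H.mem_charges_of_nbr hy dy))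
      · have := h1 _ (H.mem_charges_of_nbr hz dz) _ (H.mem_charges_of_tail hv4 T)
        simp only [Prod.mk.injEq] at this
        exact T.1 (this.2 ▸ H.irrefl v)
      · exact congrArg Prod.fst
          (h1 _ (H.mem_charges_of_tail hv4 T) _ (H.mem_charges_of_tail hv4 T'))

end RainbowPlanar

/-! ### Counting edges in the octet, and the induction. -/

namespace RainbowPlanar

open Finset

/-- A bipartite graph between four and three vertices, together with a vertex joined to the
former four, has four missing edges if it satisfies `NoK33`. -/
theorem NoK33.four_le_missing {V : Type*} {f : V → V → ℕ} (K : NoK33 f)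
    (hs : ∀ a b, f a b = f b a) {v : V} {U : Fin 4 → V} {X : Fin 3 → V}
    (hU : Function.Injective U) (hX : Function.Injective X) (hv : ∀ i, f v (U i) ≠ 0)
    (Xv : ∀ j, X j ≠ v) (Uv : ∀ i, U i ≠ v) (UX : ∀ i j, U i ≠ X j) :
    4 ≤ #{p : Fin 4 × Fin 3 | f (U p.1) (X p.2) = 0} := by
  by_contra! hM
  set M : Finset (Fin 4 × Fin 3) := {p : Fin 4 × Fin 3 | f (U p.1) (X p.2) = 0} with hMdef
  have hM' : ∃ p q r, M ⊆ {p, q, r} := by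
    obtain ⟨M', h1, h2⟩ := exists_superset_card_eq (s := M) (n := 3) (by omega) (by simp)
    obtain ⟨p, q, r, -, -, -, rfl⟩ := card_eq_three.1 h2
    exact ⟨p, q, r, h1⟩
  obtain ⟨p, q, r, hpqr⟩ := hM'
  have adj : ∀ i j, (i, j) ≠ p → (i, j) ≠ q → (i, j) ≠ r → f (U i) (X j) ≠ 0 := by
    intro i j h1 h2 h3 h
    have : (i, j) ∈ M := by simpa [hMdef] using h
    have := hpqr this
    simp [h1, h2, h3] at this
  have vU : ∀ i, f (U i) v ≠ 0 := fun i => by rw [hs]; exact hv i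
  -- If one row and one column contain all missing pairs, the other three rows form a `K₃,₃` with
  -- `v` and the other two columns. So, for three missing pairs, no two share a row or a column.
  have cover : ∀ i₀ j₀, ¬ ∀ i j, i ≠ i₀ → j ≠ j₀ → f (U i) (X j) ≠ 0 := by
    intro i₀ j₀ h
    have hi : Function.Injective (Fin.cons v X : Fin 4 → V) :=
      Fin.cons_injective_iff.2 ⟨by rintro ⟨j, hj⟩; exact Xv j hj, hX⟩
    refine K.plain (U ∘ i₀.succAbove) ((Fin.cons v X : Fin 4 → V) ∘ j₀.succ.succAbove)
      (hU.comp Fin.succAbove_right_injective) (hi.comp Fin.succAbove_right_injective)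
      fun i j => ?_
    have hne := Fin.succAbove_ne j₀.succ j
    have hne' := Fin.succAbove_ne i₀ i
    simp only [Function.comp_apply]
    generalize j₀.succ.succAbove j = k at hne
    generalize i₀.succAbove i = l at hne'
    refine Fin.cases (fun _ => by simpa using vU l) (fun k hk => ?_) k hne
    simpa using h l k hne' (by rintro rfl; exact hk rfl)
  have share : ∀ p q r : Fin 4 × Fin 3, (∀ i j, (i, j) ≠ p → (i, j) ≠ q → (i, j) ≠ r →
      f (U i) (X j) ≠ 0) → p.1 ≠ q.1 ∧ p.2 ≠ q.2 := by
    intro p q r h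
    refine ⟨fun e => cover p.1 r.2 fun i j hi hj => h i j ?_ ?_ ?_,
      fun e => cover r.1 p.2 fun i j hi hj => h i j ?_ ?_ ?_⟩ <;> rintro rfl <;> simp_all
  have s1 := share p q r adj
  have s2 := share p r q fun i j h1 h2 h3 => adj i j h1 h3 h2
  have s3 := share q r p fun i j h1 h2 h3 => adj i j h3 h1 h2
  obtain ⟨p1, p2⟩ := p
  obtain ⟨q1, q2⟩ := q
  obtain ⟨r1, r2⟩ := r
  simp only [ne_eq, Prod.mk.injEq, not_and] at s1 s2 s3 adj
  obtain ⟨t, tp, tq, tr⟩ : ∃ t : Fin 4, t ≠ p1 ∧ t ≠ q1 ∧ t ≠ r1 := by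
    clear * -
    revert p1 q1 r1
    decide
  have Uadj : ∀ i, f (U i) v ≠ 0 := vU
  have X1 := fun i j => (hX.ne_iff (x := i) (y := j))
  have U1 := fun i j => (hU.ne_iff (x := i) (y := j))
  -- The missing edge from `U r1` to `X r2` is replaced by the path through `X q2` and `U p1`, the
  -- two vertices that remain; this also avoids the missing pairs `p` and `q`.
  refine K.subdivided ![U r1, U q1, U t] ![X r2, X p2, v] ?_ ?_ ?_ (X q2) (U p1)
    (UX _ _).symm ?_ ?_ ?_ ?_ ?_ ?_ ?_ ?_
  · intro i j
    fin_cases i <;> fin_cases j <;> simp [hU.eq_iff] <;> grind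
  · intro i j
    fin_cases i <;> fin_cases j <;> simp [hX.eq_iff] <;> grind
  · intro i j
    fin_cases i <;> fin_cases j <;> simp [UX, Uv]
  · intro i
    fin_cases i <;> simp [UX]
  · intro i
    fin_cases i <;> simp [hU.eq_iff] <;> grind
  · intro i
    fin_cases i <;> simp [hX.eq_iff] <;> grind
  · intro i
    fin_cases i <;> simp [(UX _ _).symm, (Uv _).symm]
  · intro i j hij
    fin_cases i <;> fin_cases j <;> simp at hij ⊢ <;>
      first | exact vU _ | exact adj _ _ (by grind) (by grind) (by grind)
  · exact adj _ _ (by grind) (by grind) (by grind)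
  · rw [hs]
    exact adj _ _ (by grind) (by grind) (by grind)
  · exact adj _ _ (by grind) (by grind) (by grind)

variable {V : Type*} [Fintype V] [DecidableEq V] {f : V → V → ℕ}

/-- The degree sum of a closed set that is bipartite with four missing edges. -/
theorem sum_deg_octet (hs : ∀ a b, f a b = f b a) {v : V} {U : Fin 4 → V} {X : Fin 3 → V}
    (hM : 4 ≤ #{p : Fin 4 × Fin 3 | f (U p.1) (X p.2) = 0})
    (hv : ∀ u, f v u ≠ 0 → ∃ i, u = U i) (hu : ∀ i w, f (U i) w ≠ 0 → w = v ∨ ∃ j, w = X j)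
    (hx : ∀ j u, f (X j) u ≠ 0 → ∃ i, u = U i) :
    deg f v + ∑ i, deg f (U i) + ∑ j, deg f (X j) ≤ 24 := by
  have h1 : deg f v ≤ 4 := by
    refine (deg_le_card f v (univ.image U) fun b hb => ?_).trans (card_image_le.trans (by simp))
    obtain ⟨i, rfl⟩ := hv b hb
    simp
  have h2 : ∀ i, deg f (U i) ≤ 1 + #{j | f (U i) (X j) ≠ 0} := by
    intro i
    refine (deg_le_card f (U i) (insert v (({j | f (U i) (X j) ≠ 0} : Finset (Fin 3)).image X))
      fun b hb => ?_).trans ((card_insert_le _ _).trans ?_)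
    · rcases hu i b hb with rfl | ⟨j, rfl⟩
      · simp
      · refine mem_insert_of_mem (mem_image_of_mem X (by simpa using hb))
    · rw [add_comm]
      exact Nat.add_le_add_left card_image_le 1
  have h3 : ∀ j, deg f (X j) ≤ #{i | f (U i) (X j) ≠ 0} := by
    intro j
    refine (deg_le_card f (X j) (({i | f (U i) (X j) ≠ 0} : Finset (Fin 4)).image U)
      fun b hb => ?_).trans card_image_le
    obtain ⟨i, rfl⟩ := hx j b hb
    exact mem_image_of_mem U (by rw [hs] at hb; simpa using hb)
  have h4 : #{p : Fin 4 × Fin 3 | f (U p.1) (X p.2) = 0} +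
      #{p : Fin 4 × Fin 3 | f (U p.1) (X p.2) ≠ 0} = 12 := by
    rw [card_filter_add_card_filter_not]
    simp
  have h5 : ∑ i, #{j | f (U i) (X j) ≠ 0} = #{p : Fin 4 × Fin 3 | f (U p.1) (X p.2) ≠ 0} := by
    simp only [card_filter]
    rw [Fintype.sum_prod_type]
  have h6 : ∑ j, #{i | f (U i) (X j) ≠ 0} = #{p : Fin 4 × Fin 3 | f (U p.1) (X p.2) ≠ 0} := by
    simp only [card_filter]
    rw [Fintype.sum_prod_type_right]
  have h7 := sum_le_sum fun i (_ : i ∈ univ) => h2 i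
  have h8 := sum_le_sum fun j (_ : j ∈ univ) => h3 j
  rw [sum_add_distrib, h5] at h7
  rw [h6] at h8
  simp only [sum_const, card_univ, Fintype.card_fin, smul_eq_mul] at h7
  omega

theorem sum_deg_le_of_closed (H : RainbowFree f) (S : Finset V)
    (hc : ∀ a ∈ S, ∀ b, f a b ≠ 0 → b ∈ S) (hS : ∑ a ∈ S, deg f a ≤ 3 * #S)
    (hI : ∑ a : {x // x ∉ S}, deg (fun a b : {x // x ∉ S} => f a b) a ≤
      3 * Fintype.card {x // x ∉ S}) :
    ∑ a, deg f a ≤ 3 * Fintype.card V := by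
  refine sum_deg_le_of_delete H.symm S ?_ hI
  have : ∀ a ∈ S, #{b ∈ S | f a b ≠ 0} = deg f a := by
    intro a ha
    rw [deg]
    congr 1
    ext b
    simpa using hc a ha b
  have e : ∑ a ∈ S, #{b ∈ S | f a b ≠ 0} = ∑ a ∈ S, deg f a := sum_congr rfl this
  omega

/-- The inequality in `hS` says that `S` meets at most `3|S|/2` edges. A vertex of degree at most
one meets at most one edge, and two adjacent vertices of degree at most two meet at most three. -/
theorem reduced_of_not_deletable (H : RainbowFree f)
    (hS : ∀ S : Finset V, S.Nonempty →
      ¬ 2 * ∑ a ∈ S, deg f a ≤ 3 * #S + ∑ a ∈ S, #{b ∈ S | f a b ≠ 0}) : Reduced f where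
  toRainbowFree := H
  exists_adj_ne x a := by
    by_contra! h
    apply hS {x} (singleton_nonempty x)
    have : deg f x ≤ 1 := (deg_le_card f x {a} (by simpa using h)).trans (by simp)
    simp only [sum_singleton, card_singleton]
    omega
  not_adj_degLeTwo x y hxy hx hy := by
    apply hS {x, y} (insert_nonempty _ _)
    have h1 := hx.deg_le
    have h2 := hy.deg_le
    have xy := H.ne hxy
    rw [sum_pair xy, sum_pair xy, card_pair xy]
    have h3 : 0 < #{b ∈ ({x, y} : Finset V) | f x b ≠ 0} := card_pos.2 ⟨y, by simpa using hxy⟩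
    have h4 : 0 < #{b ∈ ({x, y} : Finset V) | f y b ≠ 0} :=
      card_pos.2 ⟨x, by rw [H.symm] at hxy; simpa using hxy⟩
    omega

/-- A rainbow-free coloured graph without a `K₃,₃` (possibly with one edge subdivided) has average
degree at most three. -/
theorem sum_deg_le (n : ℕ) : ∀ {V : Type} [Fintype V] {f : V → V → ℕ},
    RainbowFree f → NoK33 f → Fintype.card V = n → ∑ a, deg f a ≤ 3 * n := by
  classical
  induction n using Nat.strong_induction_on with
  | _ n ih =>
    intro V _ f H K hn
    subst hn
    have ih' : ∀ S : Finset V, S.Nonempty →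
        ∑ a : {x // x ∉ S}, deg (fun a b : {x // x ∉ S} => f a b) a ≤
          3 * Fintype.card {x // x ∉ S} := by
      intro S hS
      refine ih _ ?_ (H.comap Subtype.val_injective) (K.comap Subtype.val_injective) rfl
      obtain ⟨x, hx⟩ := hS
      exact Fintype.card_subtype_lt (x := x) (by simpa using hx)
    by_contra hc
    have R : Reduced f := reduced_of_not_deletable H fun S hS h =>
      hc (sum_deg_le_of_delete H.symm S h (ih' S hS))
    apply hc
    refine sum_deg_le_of_charges H fun v hv => ?_
    rcases R.charged_or_poor hv with h | ⟨h4, P⟩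
    · exact h
    exfalso
    -- A poor vertex is not charged: its component satisfies the bound by itself, so the induction
    -- hypothesis for the other vertices finishes the proof.
    apply hc
    obtain ⟨a, b, c, e, N⟩ := exists_nbrsFour h4
    obtain ⟨x, y, z, xy, xz, yz, xv, yv, zv, x0, y0, z0, hx, hu⟩ := R.poor_structure N P K
    obtain ⟨ha, hb, hc, he, ab, ac, ae, bc, be, ce, all⟩ := N
    have nUX : ∀ {u w}, f v u ≠ 0 → f v w = 0 → u ≠ w := by
      rintro u w h1 h2 rfl
      exact h1 h2
    set U : Fin 4 → V := ![a, b, c, e] with hUdef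
    set X : Fin 3 → V := ![x, y, z] with hXdef
    have hU : Function.Injective U := by
      intro i j
      fin_cases i <;> fin_cases j <;> simp [hUdef] <;> grind
    have hX : Function.Injective X := by
      intro i j
      fin_cases i <;> fin_cases j <;> simp [hXdef] <;> grind
    have vU : ∀ i, f v (U i) ≠ 0 := by
      intro i
      fin_cases i <;> simpa [hUdef]
    have vX : ∀ j, f v (X j) = 0 := by
      intro j
      fin_cases j <;> simpa [hXdef]
    have Xv : ∀ j, X j ≠ v := by
      intro j
      fin_cases j <;> simpa [hXdef]
    have UX : ∀ i j, U i ≠ X j := fun i j => nUX (vU i) (vX j)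
    have allU : ∀ u, f v u ≠ 0 → ∃ i, u = U i := by
      intro u h
      rcases all u h with rfl | rfl | rfl | rfl
      · exact ⟨0, rfl⟩
      · exact ⟨1, rfl⟩
      · exact ⟨2, rfl⟩
      · exact ⟨3, rfl⟩
    have allX : ∀ j u, f (X j) u ≠ 0 → ∃ i, u = U i := by
      intro j u h
      apply allU u (hx u _)
      fin_cases j
      · exact Or.inl h
      · exact Or.inr (Or.inl h)
      · exact Or.inr (Or.inr h)
    have nbU : ∀ i w, f (U i) w ≠ 0 → w = v ∨ ∃ j, w = X j := by
      intro i w h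
      rcases hu _ (vU i) w h with h | rfl | rfl | rfl
      · exact Or.inl h
      · exact Or.inr ⟨0, rfl⟩
      · exact Or.inr ⟨1, rfl⟩
      · exact Or.inr ⟨2, rfl⟩
    have M := K.four_le_missing H.symm hU hX vU Xv (fun i => (H.ne (vU i)).symm) UX
    have D := sum_deg_octet H.symm M allU nbU allX
    have dj : Disjoint (univ.image U) (univ.image X) := by
      rw [disjoint_left]
      intro w h1 h2
      simp only [mem_image, mem_univ, true_and] at h1 h2
      obtain ⟨i, rfl⟩ := h1
      obtain ⟨j, hj⟩ := h2
      exact UX i j hj.symm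
    have vn : v ∉ univ.image U ∪ univ.image X := by
      simp only [mem_union, mem_image, mem_univ, true_and, not_or]
      refine ⟨?_, ?_⟩
      · rintro ⟨i, hi⟩
        exact vU i (hi ▸ H.irrefl v)
      · rintro ⟨j, hj⟩
        exact Xv j hj
    refine sum_deg_le_of_closed H (insert v (univ.image U ∪ univ.image X)) ?_ ?_
      (ih' _ (insert_nonempty _ _))
    · intro s hs w hw
      simp only [mem_insert, mem_union, mem_image, mem_univ, true_and] at hs ⊢
      rcases hs with rfl | ⟨i, rfl⟩ | ⟨j, rfl⟩
      · obtain ⟨i, rfl⟩ := allU w hw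
        exact Or.inr (Or.inl ⟨i, rfl⟩)
      · rcases nbU i w hw with h | ⟨j, rfl⟩
        · exact Or.inl h
        · exact Or.inr (Or.inr ⟨j, rfl⟩)
      · obtain ⟨i, rfl⟩ := allX j w hw
        exact Or.inr (Or.inl ⟨i, rfl⟩)
    · rw [sum_insert vn, sum_union dj, sum_image hU.injOn, sum_image hX.injOn,
        card_insert_of_notMem vn, card_union_of_disjoint dj, card_image_of_injective _ hU,
        card_image_of_injective _ hX]
      simp only [card_univ, Fintype.card_fin]
      omega

end RainbowPlanar

/-! ### Non-planarity of `K₃,₃` by variation of the logarithm. -/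

namespace RainbowPlanar

open Complex

instance : ContractibleSpace unitInterval :=
  (convex_Icc (0 : ℝ) 1).contractibleSpace ⟨0, by simp⟩

instance : LocallyPathConnectedSpace unitInterval :=
  (convex_Icc (0 : ℝ) 1).locallyPathConnectedSpace

theorem exists_continuous_log {A : Type*} [TopologicalSpace A] [SimplyConnectedSpace A]
    [LocallyPathConnectedSpace A] (g : C(A, ℂ)) (hg : ∀ x, g x ≠ 0) :
    ∃ L : C(A, ℂ), ∀ x, exp (L x) = g x := by
  obtain ⟨x₀⟩ : Nonempty A := inferInstance
  obtain ⟨L, ⟨-, hL⟩, -⟩ := isCoveringMapOn_exp.existsUnique_continuousMap_lifts g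
    (exp_log (hg x₀)) hg
  exact ⟨L, fun x => congrFun hL x⟩

/-- Shifted to the starting value of `L`, the logarithm `L'` becomes a lift of the same path through
the covering `exp`, hence equal to `L`. -/
theorem continuous_log_unique {L L' : C(unitInterval, ℂ)} (h : ∀ t, exp (L t) = exp (L' t)) :
    L 1 - L 0 = L' 1 - L' 0 := by
  let g : C(unitInterval, ℂ) := ⟨fun t => exp (L t), by fun_prop⟩
  obtain ⟨F, -, hF⟩ := isCoveringMapOn_exp.existsUnique_continuousMap_lifts g
    (a₀ := 0) (e₀ := L 0) rfl fun t => exp_ne_zero _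
  have h1 := hF L ⟨rfl, rfl⟩
  have h2 := hF (L' + ContinuousMap.const unitInterval (L 0 - L' 0)) ⟨by simp, by
    funext t
    simp [g, exp_add, exp_sub, ← h]⟩
  have h3 : L 1 = L' 1 + (L 0 - L' 0) := by
    conv_lhs => rw [h1, ← h2]
    simp
  rw [h3]
  ring

open Classical in
/-- The variation of the logarithm along a non-vanishing path. -/
noncomputable def logVar (g : C(unitInterval, ℂ)) : ℂ :=
  if h : ∃ L : C(unitInterval, ℂ), ∀ t, exp (L t) = g t then h.choose 1 - h.choose 0 else 0

theorem logVar_eq {g L : C(unitInterval, ℂ)} (hL : ∀ t, exp (L t) = g t) : logVar g = L 1 - L 0 := by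
  have h : ∃ L : C(unitInterval, ℂ), ∀ t, exp (L t) = g t := ⟨L, hL⟩
  rw [logVar, dif_pos h]
  exact continuous_log_unique fun t => by rw [hL, h.choose_spec]

theorem exp_logVar {g : C(unitInterval, ℂ)} (hg : ∀ t, g t ≠ 0) : exp (logVar g) = g 1 / g 0 := by
  obtain ⟨L, hL⟩ := exists_continuous_log g hg
  rw [logVar_eq hL, exp_sub, hL, hL]

theorem logVar_neg {g g' : C(unitInterval, ℂ)} (hg : ∀ t, g t ≠ 0) (h : ∀ t, g' t = -g t) :
    logVar g' = logVar g := by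
  obtain ⟨L, hL⟩ := exists_continuous_log g hg
  rw [logVar_eq hL, logVar_eq (L := L + ContinuousMap.const unitInterval (Real.pi * I)) fun t => by
    simp [exp_add, hL, h]]
  simp

/-- The variation of the logarithm around the boundary of a square vanishes. -/
theorem logVar_square {F : C(unitInterval × unitInterval, ℂ)} (hF : ∀ x, F x ≠ 0) {g₁ g₂ g₃ g₄ : C(unitInterval, ℂ)}
    (h₁ : ∀ s, g₁ s = F (s, 0)) (h₂ : ∀ t, g₂ t = F (1, t)) (h₃ : ∀ t, g₃ t = F (0, t))
    (h₄ : ∀ s, g₄ s = F (s, 1)) : logVar g₁ + logVar g₂ = logVar g₃ + logVar g₄ := by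
  obtain ⟨L, hL⟩ := exists_continuous_log F hF
  rw [logVar_eq (L := ⟨fun s => L (s, 0), by fun_prop⟩) fun t => by simp [hL, h₁],
    logVar_eq (L := ⟨fun s => L (1, s), by fun_prop⟩) fun t => by simp [hL, h₂],
    logVar_eq (L := ⟨fun s => L (0, s), by fun_prop⟩) fun t => by simp [hL, h₃],
    logVar_eq (L := ⟨fun s => L (s, 1), by fun_prop⟩) fun t => by simp [hL, h₄]]
  simp only [ContinuousMap.coe_mk]
  ring

/-- There are no nine arcs from three points to three points such that arcs without common end are
disjoint. -/
theorem no_K33_arcs {a b : Fin 3 → ℂ} {γ : Fin 3 → Fin 3 → C(unitInterval, ℂ)} (h0 : ∀ i j, γ i j 0 = a i)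
    (h1 : ∀ i j, γ i j 1 = b j)
    (h : ∀ i j k l, i ≠ k → j ≠ l → ∀ s t, γ i j s ≠ γ k l t) : False := by
  have ea : ∀ i j k, i ≠ k → ∀ s, γ i j s - a k ≠ 0 := by
    intro i j k hik s
    obtain ⟨l, hl⟩ : ∃ l : Fin 3, j ≠ l := ⟨j + 1, by revert j; decide⟩
    rw [← h0 k l, sub_ne_zero]
    exact h i j k l hik hl s 0
  have eb : ∀ i j l, j ≠ l → ∀ s, γ i j s - b l ≠ 0 := by
    intro i j l hjl s
    obtain ⟨k, hk⟩ : ∃ k : Fin 3, i ≠ k := ⟨i + 1, by revert i; decide⟩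
    rw [← h1 k l, sub_ne_zero]
    exact h i j k l hk hjl s 1
  have aa : ∀ i k, i ≠ k → a i - a k ≠ 0 := fun i k hik => by
    have := ea i 0 k hik 0
    rwa [h0] at this
  have bb : ∀ j l, j ≠ l → b j - b l ≠ 0 := fun j l hjl => by
    have := eb 0 j l hjl 1
    rwa [h1] at this
  have ba : ∀ j k, b j - a k ≠ 0 := fun j k => by
    obtain ⟨i, hi⟩ : ∃ i : Fin 3, i ≠ k := ⟨k + 1, by revert k; decide⟩
    have := ea i j k hi 1
    rwa [h1] at this
  let P : Fin 3 → Fin 3 → Fin 3 → C(unitInterval, ℂ) := fun i j k => ⟨fun s => γ i j s - a k, by fun_prop⟩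
  let Q : Fin 3 → Fin 3 → Fin 3 → C(unitInterval, ℂ) := fun i j l => ⟨fun s => γ i j s - b l, by fun_prop⟩
  -- The difference `γ i j s - γ k l t` has no zero on the unit square. Two sides carry the opposite
  -- sign, which does not affect the variation.
  have sq : ∀ i j k l, i ≠ k → j ≠ l → logVar (P i j k) + logVar (Q k l j) =
      logVar (P k l i) + logVar (Q i j l) := by
    intro i j k l hik hjl
    let N : C(unitInterval, ℂ) → C(unitInterval, ℂ) := fun g => ⟨fun s => -g s, by fun_prop⟩
    rw [← logVar_neg (g := Q k l j) (g' := N (Q k l j)) (eb k l j hjl.symm) fun t => rfl,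
      ← logVar_neg (g := P k l i) (g' := N (P k l i)) (ea k l i hik.symm) fun t => rfl]
    refine logVar_square (F := ⟨fun x => γ i j x.1 - γ k l x.2, by fun_prop⟩)
      (fun x => sub_ne_zero.2 (h i j k l hik hjl _ _)) (fun s => ?_) (fun t => ?_) (fun t => ?_)
      (fun s => ?_) <;> simp [N, P, Q, h0, h1]
  -- These are logarithms of `a i - a k` chosen so that reversing a pair with `i < k` adds exactly
  -- `πi`; likewise for `β`.
  let α : Fin 3 → Fin 3 → ℂ := fun i k =>
    if i < k then log (a i - a k) else log (a k - a i) + Real.pi * I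
  let β : Fin 3 → Fin 3 → ℂ := fun j l =>
    if j < l then log (b j - b l) else log (b l - b j) + Real.pi * I
  have hα : ∀ i k, i ≠ k → exp (α i k) = a i - a k := by
    intro i k hik
    by_cases hlt : i < k
    · simp only [α, if_pos hlt, exp_log (aa i k hik)]
    · simp only [α, if_neg hlt, exp_add, exp_log (aa k i hik.symm), exp_pi_mul_I]
      ring
  have hβ : ∀ i k, i ≠ k → exp (β i k) = b i - b k := by
    intro i k hik
    by_cases hlt : i < k
    · simp only [β, if_pos hlt, exp_log (bb i k hik)]
    · simp only [β, if_neg hlt, exp_add, exp_log (bb k i hik.symm), exp_pi_mul_I]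
      ring
  have hP : ∀ i j k, ∃ m : ℤ, i ≠ k →
      logVar (P i j k) = log (b j - a k) - α i k + m * (2 * Real.pi * I) := by
    intro i j k
    by_cases hik : i = k
    · exact ⟨0, fun h => (h hik).elim⟩
    · obtain ⟨m, hm⟩ := exp_eq_exp_iff_exists_int.1
        (show exp (logVar (P i j k)) = exp (log (b j - a k) - α i k) by
          rw [exp_logVar (g := P i j k) (ea i j k hik), exp_sub, exp_log (ba j k), hα i k hik]
          simp [P, h0, h1])
      exact ⟨m, fun _ => hm⟩
  have hQ : ∀ i j l, ∃ m : ℤ, j ≠ l → logVar (Q i j l) =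
      β j l - log (b l - a i) - Real.pi * I + m * (2 * Real.pi * I) := by
    intro i j l
    by_cases hjl : j = l
    · exact ⟨0, fun h => (h hjl).elim⟩
    · obtain ⟨m, hm⟩ := exp_eq_exp_iff_exists_int.1
        (show exp (logVar (Q i j l)) = exp (β j l - log (b l - a i) - Real.pi * I) by
          rw [exp_logVar (g := Q i j l) (eb i j l hjl), exp_sub, exp_sub, exp_log (ba l i),
            hβ j l hjl, exp_pi_mul_I]
          simp only [Q, h0, h1, ContinuousMap.coe_mk]
          rw [div_div, mul_neg_one, neg_sub])
      exact ⟨m, fun _ => hm⟩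
  choose m hm using hP
  choose n hn using hQ
  have hpi : (2 * Real.pi * I : ℂ) ≠ 0 := two_pi_I_ne_zero
  -- The two half turns from `α` and `β` add up to `2πi` if both index pairs increase, and cancel in
  -- the opposite case `e2`.
  have e1 : ∀ i j k l, i < k → j < l → m k l i + n i j l - m i j k - n k l j = 1 := by
    intro i j k l hik hjl
    have := sq i j k l hik.ne hjl.ne
    rw [hm i j k hik.ne, hm k l i hik.ne', hn k l j hjl.ne', hn i j l hjl.ne] at this
    simp only [α, β, if_pos hik, if_pos hjl, if_neg hik.not_gt, if_neg hjl.not_gt] at this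
    have h2 : ((m k l i + n i j l - m i j k - n k l j : ℤ) : ℂ) * (2 * Real.pi * I) =
        ((1 : ℤ) : ℂ) * (2 * Real.pi * I) := by
      push_cast
      linear_combination -this
    exact_mod_cast mul_right_cancel₀ hpi h2
  have e2 : ∀ i j k l, i < k → l < j → m k l i + n i j l - m i j k - n k l j = 0 := by
    intro i j k l hik hjl
    have := sq i j k l hik.ne hjl.ne'
    rw [hm i j k hik.ne, hm k l i hik.ne', hn k l j hjl.ne, hn i j l hjl.ne'] at this
    simp only [α, β, if_pos hik, if_pos hjl, if_neg hik.not_gt, if_neg hjl.not_gt] at this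
    have h2 : ((m k l i + n i j l - m i j k - n k l j : ℤ) : ℂ) * (2 * Real.pi * I) =
        ((0 : ℤ) : ℂ) * (2 * Real.pi * I) := by
      push_cast
      linear_combination -this
    exact_mod_cast mul_right_cancel₀ hpi h2
  have l01 : (0 : Fin 3) < 1 := by decide
  have l02 : (0 : Fin 3) < 2 := by decide
  have l12 : (1 : Fin 3) < 2 := by decide
  have := e1 0 0 1 1 l01 l01
  have := e1 0 0 1 2 l01 l02
  have := e1 0 1 1 2 l01 l12
  have := e1 0 0 2 1 l02 l01
  have := e1 0 0 2 2 l02 l02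
  have := e1 0 1 2 2 l02 l12
  have := e1 1 0 2 1 l12 l01
  have := e1 1 0 2 2 l12 l02
  have := e1 1 1 2 2 l12 l12
  have := e2 0 1 1 0 l01 l01
  have := e2 0 2 1 0 l01 l02
  have := e2 0 2 1 1 l01 l12
  have := e2 0 1 2 0 l02 l01
  have := e2 0 2 2 0 l02 l02
  have := e2 0 2 2 1 l02 l12
  have := e2 1 1 2 0 l12 l01
  have := e2 1 2 2 0 l12 l02
  have := e2 1 2 2 1 l12 l12
  -- Modulo two: each unknown occurs in exactly two of the eighteen equations, while the right-hand
  -- sides sum to nine.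
  omega

end RainbowPlanar

/-! ### From plane drawings and edge-colourings to the upper bound. -/

namespace RainbowPlanar

open SimpleGraph

namespace PlaneDrawing

variable {V : Type*} {G : SimpleGraph V} (D : PlaneDrawing G)

theorem exists_path {a b : V} (h : G.Adj a b) :
    ∃ γ : Path (D.point a) (D.point b), ∀ s, γ s ∈ Set.range (D.arc ⟨s(a, b), h⟩) := by
  have he := D.arc_ends ⟨s(a, b), h⟩
  rw [Sym2.map_mk, Sym2.eq_iff] at he
  rcases he with ⟨h0, h1⟩ | ⟨h0, h1⟩
  · exact ⟨⟨D.arc ⟨s(a, b), h⟩, h0, h1⟩, fun s => ⟨s, rfl⟩⟩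
  · exact ⟨Path.symm ⟨D.arc ⟨s(a, b), h⟩, h0, h1⟩, fun s => ⟨unitInterval.symm s, rfl⟩⟩

theorem exists_point_of_end (e : G.edgeSet) {s : unitInterval} (hs : s = 0 ∨ s = 1) :
    ∃ v ∈ e.1, D.point v = D.arc e s := by
  have he := D.arc_ends e
  have : D.arc e s ∈ Sym2.map D.point e.1 := by
    rw [← he]
    rcases hs with rfl | rfl <;> simp
  rwa [Sym2.mem_map] at this

/-- A common point of two different arcs is an end of both, so it represents a common vertex. -/
theorem arc_ne_arc {e f : G.edgeSet} (h : ∀ v, v ∈ e.1 → v ∉ f.1) (s t : unitInterval) :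
    D.arc e s ≠ D.arc f t := by
  intro hst
  have hne : e ≠ f := by
    rintro rfl
    obtain ⟨v, hv, -⟩ := D.exists_point_of_end e (s := 0) (Or.inl rfl)
    exact h v hv hv
  obtain ⟨v, hv, hv'⟩ := D.exists_point_of_end e (D.arcs_disjoint e f hne s t hst)
  obtain ⟨w, hw, hw'⟩ := D.exists_point_of_end f (D.arcs_disjoint f e hne.symm t s hst.symm)
  obtain rfl : v = w := D.point_injective (by rw [hv', hw', hst])
  exact h v hv hw

/-- `S i j` contains the edges along which `γ i j` runs, so that a subdivided edge is treated like a
single one. -/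
theorem no_K33 {a b : Fin 3 → V} (S : Fin 3 → Fin 3 → Set G.edgeSet)
    (γ : ∀ i j, Path (D.point (a i)) (D.point (b j)))
    (hγ : ∀ i j s, ∃ e ∈ S i j, γ i j s ∈ Set.range (D.arc e))
    (hS : ∀ i j k l, i ≠ k → j ≠ l → ∀ e ∈ S i j, ∀ f ∈ S k l, ∀ v, v ∈ e.1 → v ∉ f.1) :
    False := by
  let φ : EuclideanSpace ℝ (Fin 2) ≃ₗᵢ[ℝ] ℂ := Complex.orthonormalBasisOneI.repr.symm
  refine no_K33_arcs (a := fun i => φ (D.point (a i))) (b := fun j => φ (D.point (b j)))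
    (γ := fun i j => ⟨fun s => φ (γ i j s), by fun_prop⟩) (by simp) (by simp) ?_
  intro i j k l hik hjl s t hst
  have h : γ i j s = γ k l t := φ.injective hst
  obtain ⟨e, he, s', hs'⟩ := hγ i j s
  obtain ⟨f, hf, t', ht'⟩ := hγ k l t
  exact D.arc_ne_arc (hS i j k l hik hjl e he f hf) s' t' (by rw [hs', ht', h])

end PlaneDrawing

theorem IsPlanar.noK33 {V : Type*} {G : SimpleGraph V} (hG : IsPlanar G) {f : V → V → ℕ}
    (hf : ∀ a b, f a b ≠ 0 ↔ G.Adj a b) : NoK33 f := by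
  obtain ⟨D⟩ := hG
  constructor
  · intro a b ha hb h
    have hadj : ∀ i j, G.Adj (a i) (b j) := fun i j => (hf _ _).1 (h i j)
    have hab : ∀ i j, a i ≠ b j := fun i j => (hadj i j).ne
    choose γ hγ using fun i j => D.exists_path (hadj i j)
    refine D.no_K33 (fun i j => {⟨s(a i, b j), hadj i j⟩}) γ (fun i j s => ⟨_, rfl, hγ i j s⟩) ?_
    rintro i j k l hik hjl e rfl f rfl v hv hv'
    simp only [Sym2.mem_iff] at hv hv'
    rcases hv with rfl | rfl <;> rcases hv' with h1 | h1
    · exact hik (ha h1)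
    · exact hab _ _ h1
    · exact hab _ _ h1.symm
    · exact hjl (hb h1)
  · intro a b ha hb hab p q hpq hap haq hbp hbq h h1 h2 h3
    have hadj : ∀ i j, (i, j) ≠ ((0 : Fin 3), (0 : Fin 3)) → G.Adj (a i) (b j) :=
      fun i j hij => (hf _ _).1 (h i j hij)
    rw [hf] at h1 h2 h3
    obtain ⟨γ₁, hγ₁⟩ := D.exists_path h1
    obtain ⟨γ₂, hγ₂⟩ := D.exists_path h2
    obtain ⟨γ₃, hγ₃⟩ := D.exists_path h3
    have key : ∀ i j, ∃ (S : Set G.edgeSet) (γ : Path (D.point (a i)) (D.point (b j))),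
        (∀ s, ∃ e ∈ S, γ s ∈ Set.range (D.arc e)) ∧
        ∀ e ∈ S, ∀ v ∈ e.1, v = a i ∨ v = b j ∨ ((i, j) = (0, 0) ∧ (v = p ∨ v = q)) := by
      intro i j
      by_cases hij : (i, j) = (0, 0)
      · obtain ⟨rfl, rfl⟩ : i = 0 ∧ j = 0 := by simpa using hij
        refine ⟨{⟨s(a 0, p), h1⟩, ⟨s(p, q), h2⟩, ⟨s(q, b 0), h3⟩}, (γ₁.trans γ₂).trans γ₃,
          fun s => ?_, ?_⟩
        · have hs : ((γ₁.trans γ₂).trans γ₃) s ∈ Set.range ((γ₁.trans γ₂).trans γ₃) := ⟨s, rfl⟩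
          rw [Path.trans_range, Path.trans_range] at hs
          rcases hs with (⟨t, ht⟩ | ⟨t, ht⟩) | ⟨t, ht⟩
          · exact ⟨⟨s(a 0, p), h1⟩, by simp, ht ▸ hγ₁ t⟩
          · exact ⟨⟨s(p, q), h2⟩, by simp, ht ▸ hγ₂ t⟩
          · exact ⟨⟨s(q, b 0), h3⟩, by simp, ht ▸ hγ₃ t⟩
        · rintro e (rfl | rfl | rfl) v hv <;> simp only [Sym2.mem_iff] at hv <;> tauto
      · obtain ⟨γ, hγ⟩ := D.exists_path (hadj i j hij)
        refine ⟨{⟨s(a i, b j), hadj i j hij⟩}, γ, fun s => ⟨_, rfl, hγ s⟩, ?_⟩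
        rintro e rfl v hv
        simp only [Sym2.mem_iff] at hv
        tauto
    choose S γ hγ hS using key
    refine D.no_K33 S γ hγ ?_
    intro i j k l hik hjl e he f hf v hv hv'
    rcases hS i j e he v hv with rfl | rfl | ⟨h0, h0'⟩ <;>
      rcases hS k l f hf _ hv' with h4 | h4 | ⟨h4, h4'⟩
    · exact hik (ha h4)
    · exact hab _ _ h4
    · rcases h4' with h5 | h5
      · exact hap _ h5
      · exact haq _ h5
    · exact hab _ _ h4.symm
    · exact hjl (hb h4)
    · rcases h4' with h5 | h5
      · exact hbp _ h5
      · exact hbq _ h5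
    · rcases h0' with rfl | rfl
      · exact hap _ h4.symm
      · exact haq _ h4.symm
    · rcases h0' with rfl | rfl
      · exact hbp _ h4.symm
      · exact hbq _ h4.symm
    · simp only [Prod.mk.injEq] at h0 h4
      exact hik (h0.1.trans h4.1.symm)

theorem pathGraph_five_edge {e : Sym2 (Fin 5)} (he : e ∈ (pathGraph 5).edgeSet) :
    e = s(0, 1) ∨ e = s(1, 2) ∨ e = s(2, 3) ∨ e = s(3, 4) := by
  induction e with | _ x y
  rw [mem_edgeSet, pathGraph_adj] at he
  revert x y
  decide

open Classical in
/-- The colour of the edge `s(a, b)` plus one, and `0` if there is no such edge. -/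
noncomputable def edgeColor {V : Type*} {G : SimpleGraph V} (c : G.EdgeLabeling ℕ) (a b : V) : ℕ :=
  if h : G.Adj a b then c ⟨s(a, b), h⟩ + 1 else 0

section edgeColor

variable {V : Type*} {G : SimpleGraph V} {c : G.EdgeLabeling ℕ} {a b : V}

theorem edgeColor_ne_zero : edgeColor c a b ≠ 0 ↔ G.Adj a b := by
  unfold edgeColor
  split_ifs with h <;> simp [h]

theorem edgeColor_of_adj (h : G.Adj a b) : edgeColor c a b = c ⟨s(a, b), h⟩ + 1 := dif_pos h

theorem edgeColor_comm (a b : V) : edgeColor c a b = edgeColor c b a := by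
  by_cases h : G.Adj a b
  · rw [edgeColor_of_adj h, edgeColor_of_adj h.symm]
    simp only [Sym2.eq_swap]
  · have h' : ¬ G.Adj b a := fun h' => h h'.symm
    rw [edgeColor, edgeColor, dif_neg h, dif_neg h']

theorem edgeColor_rainbowFree (hc : IsProperColoring c)
    (hr : ¬ ContainsRainbow c (pathGraph 5)) : RainbowFree (edgeColor c) := by
  refine ⟨edgeColor_comm, fun a => ?_, fun a b d h h' => ?_, ?_⟩
  · by_contra h
    exact (edgeColor_ne_zero.1 h).ne rfl
  · have hb := edgeColor_ne_zero.1 h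
    rw [h'] at h
    have hd := edgeColor_ne_zero.1 h
    rw [edgeColor_of_adj hb, edgeColor_of_adj hd] at h'
    by_contra hbd
    refine hc ⟨s(a, b), hb⟩ ⟨s(a, d), hd⟩ ?_ ⟨a, by simp⟩ (by omega)
    simpa [Subtype.ext_iff, hb.ne', hd.ne'] using hbd
  · intro x₀ x₁ x₂ x₃ x₄ h01 h12 h23 h34 n02 n03 n04 n13 n14 n24
    rw [edgeColor_ne_zero] at h01 h12 h23 h34
    rw [edgeColor_of_adj h01, edgeColor_of_adj h12, edgeColor_of_adj h23, edgeColor_of_adj h34]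
    by_contra hcon
    push Not at hcon
    obtain ⟨c1, c2, c3⟩ := hcon
    -- Consecutive edges differ by properness, which is why `RainbowFree` compares only the three
    -- other pairs.
    have d1 : c ⟨s(x₀, x₁), h01⟩ ≠ c ⟨s(x₁, x₂), h12⟩ :=
      hc _ _ (by simp [Subtype.ext_iff, n02, h01.ne]) ⟨x₁, by simp⟩
    have d2 : c ⟨s(x₁, x₂), h12⟩ ≠ c ⟨s(x₂, x₃), h23⟩ :=
      hc _ _ (by simp [Subtype.ext_iff, n13, h12.ne]) ⟨x₂, by simp⟩
    have d3 : c ⟨s(x₂, x₃), h23⟩ ≠ c ⟨s(x₃, x₄), h34⟩ :=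
      hc _ _ (by simp [Subtype.ext_iff, n24, h23.ne]) ⟨x₃, by simp⟩
    have hadj : ∀ i j, (pathGraph 5).Adj i j →
        G.Adj (![x₀, x₁, x₂, x₃, x₄] i) (![x₀, x₁, x₂, x₃, x₄] j) := by
      intro i j hij
      rw [pathGraph_adj] at hij
      fin_cases i <;> fin_cases j <;> simp_all [G.adj_comm]
    refine hr ⟨⟨⟨![x₀, x₁, x₂, x₃, x₄], fun {i j} => hadj i j⟩, ?_⟩, ?_⟩
    · intro i j hij
      have := h01.ne
      have := h12.ne
      have := h23.ne
      have := h34.ne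
      fin_cases i <;> fin_cases j <;> simp_all
    · rintro ⟨e, he⟩ ⟨e', he'⟩ h
      rw [Subtype.mk.injEq]
      simp only [Hom.mapEdgeSet] at h
      rcases pathGraph_five_edge he with rfl | rfl | rfl | rfl <;>
        rcases pathGraph_five_edge he' with rfl | rfl | rfl | rfl <;>
        first
        | rfl
        | (exfalso; simp at h; omega)

end edgeColor

theorem sum_deg_eq {V : Type*} [Fintype V] {G : SimpleGraph V} {f : V → V → ℕ}
    (h : ∀ a b, f a b ≠ 0 ↔ G.Adj a b) : ∑ a, deg f a = 2 * G.edgeSet.ncard := by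
  classical
  rw [← coe_edgeFinset, Set.ncard_coe_finset, ← sum_degrees_eq_twice_card_edges]
  refine Finset.sum_congr rfl fun a _ => ?_
  rw [deg, ← card_neighborFinset_eq_degree]
  congr 1
  ext b
  simp [h]

theorem edge_ncard_le {n : ℕ} {G : SimpleGraph (Fin n)} (hG : IsPlanar G) {c : G.EdgeLabeling ℕ}
    (hc : IsProperColoring c) (hr : ¬ ContainsRainbow c (pathGraph 5)) :
    G.edgeSet.ncard ≤ 3 * n / 2 := by
  have h := sum_deg_le n (edgeColor_rainbowFree hc hr)
    (hG.noK33 fun a b => edgeColor_ne_zero) (Fintype.card_fin n)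
  rw [sum_deg_eq (G := G) fun a b => edgeColor_ne_zero] at h
  omega

end RainbowPlanar

/-! ### Disjoint unions of coloured plane graphs. -/

namespace RainbowPlanar

open SimpleGraph

namespace RainbowFree

variable {V : Type*} {f : V → V → ℕ}

/-- The graph of the pairs with nonzero colour. -/
def toGraph (H : RainbowFree f) : SimpleGraph V where
  Adj a b := f a b ≠ 0
  symm := ⟨fun a b h => by rwa [H.symm b a]⟩
  loopless := ⟨fun a h => h (H.irrefl a)⟩

/-- The edge-colouring of `H.toGraph` given by `f`. -/
def coloring (H : RainbowFree f) : H.toGraph.EdgeLabeling ℕ :=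
  fun e => Sym2.lift ⟨f, H.symm⟩ e.1

theorem coloring_proper (H : RainbowFree f) : IsProperColoring H.coloring := by
  rintro ⟨e, he⟩ ⟨e', he'⟩ hne ⟨v, hv, hv'⟩ h
  obtain ⟨a, rfl⟩ := Sym2.mem_iff_exists.1 hv
  obtain ⟨b, rfl⟩ := Sym2.mem_iff_exists.1 hv'
  obtain rfl := H.proper v a b he h
  exact hne rfl

theorem not_containsRainbow (H : RainbowFree f) :
    ¬ ContainsRainbow H.coloring (pathGraph 5) := by
  rintro ⟨g, hg⟩
  have e1 : (pathGraph 5).Adj 0 1 := by simp [pathGraph_adj]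
  have e2 : (pathGraph 5).Adj 1 2 := by simp [pathGraph_adj]
  have e3 : (pathGraph 5).Adj 2 3 := by simp [pathGraph_adj]
  have e4 : (pathGraph 5).Adj 3 4 := by simp [pathGraph_adj]
  have hn : ∀ i j : Fin 5, i ≠ j → g i ≠ g j := fun i j h h' => h (g.injective h')
  rcases H.not_rainbow _ _ _ _ _ (g.toHom.map_adj e1) (g.toHom.map_adj e2)
    (g.toHom.map_adj e3) (g.toHom.map_adj e4) (hn 0 2 (by decide)) (hn 0 3 (by decide))
    (hn 0 4 (by decide)) (hn 1 3 (by decide)) (hn 1 4 (by decide)) (hn 2 4 (by decide))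
    with h | h | h
  · exact absurd (congrArg Subtype.val (@hg ⟨s(0, 1), e1⟩ ⟨s(2, 3), e3⟩ h))
      (show (s(0, 1) : Sym2 (Fin 5)) ≠ s(2, 3) by decide)
  · exact absurd (congrArg Subtype.val (@hg ⟨s(0, 1), e1⟩ ⟨s(3, 4), e4⟩ h))
      (show (s(0, 1) : Sym2 (Fin 5)) ≠ s(3, 4) by decide)
  · exact absurd (congrArg Subtype.val (@hg ⟨s(1, 2), e2⟩ ⟨s(3, 4), e4⟩ h))
      (show (s(1, 2) : Sym2 (Fin 5)) ≠ s(3, 4) by decide)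

end RainbowFree

theorem IsPlanar.of_copy {V W : Type*} {G : SimpleGraph V} {H : SimpleGraph W} (hH : IsPlanar H)
    (φ : Copy G H) : IsPlanar G := by
  obtain ⟨D⟩ := hH
  refine ⟨⟨fun v => D.point (φ v), fun e => D.arc (φ.toHom.mapEdgeSet e),
    D.point_injective.comp φ.injective, fun e => D.arc_injective _, fun e => ?_,
    fun e t v => D.arc_avoids_points _ t _, fun e e' h => D.arcs_disjoint _ _ ?_⟩⟩
  · rw [D.arc_ends]
    exact Sym2.map_map _
  · exact (Hom.mapEdgeSet.injective _ φ.injective).ne h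

/-- The plane drawing obtained by applying an injective continuous map. -/
def PlaneDrawing.map {V : Type*} {G : SimpleGraph V} (D : PlaneDrawing G)
    (ψ : C(EuclideanSpace ℝ (Fin 2), EuclideanSpace ℝ (Fin 2))) (hψ : Function.Injective ψ) :
    PlaneDrawing G where
  point v := ψ (D.point v)
  arc e := ψ.comp (D.arc e)
  point_injective := hψ.comp D.point_injective
  arc_injective e := hψ.comp (D.arc_injective e)
  arc_ends e := by
    have h := congrArg (Sym2.map ψ) (D.arc_ends e)
    rwa [Sym2.map_map] at h
  arc_avoids_points e t v h := D.arc_avoids_points e t v (hψ h)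
  arcs_disjoint e f hef s t h := D.arcs_disjoint e f hef s t (hψ h)

/-- The disjoint union of two coloured graphs. -/
def sumColor {V W : Type*} (f : V → V → ℕ) (g : W → W → ℕ) : V ⊕ W → V ⊕ W → ℕ
  | .inl a, .inl b => f a b
  | .inr a, .inr b => g a b
  | _, _ => 0

/-- A path is connected, so it stays within one summand. -/
theorem RainbowFree.sum {V W : Type*} {f : V → V → ℕ} {g : W → W → ℕ} (hf : RainbowFree f)
    (hg : RainbowFree g) : RainbowFree (sumColor f g) where
  symm := by
    rintro (a | a) (b | b)
    exacts [hf.symm a b, rfl, rfl, hg.symm a b]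
  irrefl := by
    rintro (a | a)
    exacts [hf.irrefl a, hg.irrefl a]
  proper := by
    rintro (a | a) (b | b) (c | c) h h' <;> simp only [sumColor, ne_eq, not_true_eq_false] at h h'
    · rw [hf.proper a b c h h']
    · exact absurd h' h
    · exact absurd h' h
    · rw [hg.proper a b c h h']
  not_rainbow := by
    rintro (a | a) (b | b) (c | c) (d | d) (e | e) h1 h2 h3 h4
    all_goals
      simp only [sumColor, ne_eq, not_true_eq_false] at h1 h2 h3 h4
    all_goals
      simp only [ne_eq, Sum.inl.injEq, Sum.inr.injEq, sumColor]
    · exact hf.not_rainbow a b c d e h1 h2 h3 h4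
    · exact hg.not_rainbow a b c d e h1 h2 h3 h4

theorem sum_deg_sumColor {V W : Type*} [Fintype V] [Fintype W] (f : V → V → ℕ) (g : W → W → ℕ) :
    ∑ x, deg (sumColor f g) x = ∑ a, deg f a + ∑ b, deg g b := by
  simp only [deg_eq_sum, Fintype.sum_sum_type, sumColor, ne_eq, not_true_eq_false, if_false,
    Finset.sum_const_zero, add_zero, zero_add]
  congr!

theorem PlaneDrawing.sum {V W : Type*} {G : SimpleGraph V} {H : SimpleGraph W}
    (D : PlaneDrawing G) (E : PlaneDrawing H) (hD : ∀ v, 0 < D.point v 0)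
    (hD' : ∀ e t, 0 < D.arc e t 0) (hE : ∀ v, E.point v 0 < 0) (hE' : ∀ e t, E.arc e t 0 < 0)
    {K : SimpleGraph (V ⊕ W)} (hl : ∀ a b, K.Adj (.inl a) (.inl b) → G.Adj a b)
    (hr : ∀ a b, K.Adj (.inr a) (.inr b) → H.Adj a b) (hlr : ∀ a b, ¬ K.Adj (.inl a) (.inr b)) :
    IsPlanar K := by
  have key : ∀ e : K.edgeSet, ∃ γ : C(unitInterval, EuclideanSpace ℝ (Fin 2)),
      (∃ e' : G.edgeSet, e.1 = Sym2.map .inl e'.1 ∧ γ = D.arc e') ∨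
      (∃ e' : H.edgeSet, e.1 = Sym2.map .inr e'.1 ∧ γ = E.arc e') := by
    rintro ⟨e, he⟩
    induction e with | _ x y
    rcases x with a | a <;> rcases y with b | b
    · exact ⟨_, Or.inl ⟨⟨s(a, b), hl a b he⟩, rfl, rfl⟩⟩
    · exact absurd he (hlr a b)
    · exact absurd (K.adj_symm he) (hlr b a)
    · exact ⟨_, Or.inr ⟨⟨s(a, b), hr a b he⟩, rfl, rfl⟩⟩
  choose γ hγ using key
  refine ⟨⟨Sum.elim D.point E.point, γ, ?_, fun e => ?_, fun e => ?_, fun e t v h => ?_,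
    fun e e' hee s t h => ?_⟩⟩
  · rintro (a | a) (b | b) h <;> simp only [Sum.elim_inl, Sum.elim_inr] at h
    · rw [D.point_injective h]
    · have := hD a
      have := hE b
      rw [h] at *
      linarith
    · have := hD b
      have := hE a
      rw [h] at *
      linarith
    · rw [E.point_injective h]
  · rcases hγ e with ⟨e', -, h⟩ | ⟨e', -, h⟩ <;> rw [h]
    exacts [D.arc_injective e', E.arc_injective e']
  · rcases hγ e with ⟨e', h', h⟩ | ⟨e', h', h⟩ <;> rw [h, h', Sym2.map_map]
    exacts [D.arc_ends e', E.arc_ends e']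
  · rcases hγ e with ⟨e', -, h1⟩ | ⟨e', -, h1⟩ <;> rw [h1] at h <;> rcases v with a | a <;>
      simp only [Sum.elim_inl, Sum.elim_inr] at h
    · exact D.arc_avoids_points e' t a h
    · have := hD' e' t
      rw [h] at this
      linarith [hE a]
    · have := hE' e' t
      rw [h] at this
      linarith [hD a]
    · exact E.arc_avoids_points e' t a h
  · rcases hγ e with ⟨e₁, h1, h2⟩ | ⟨e₁, h1, h2⟩ <;>
      rcases hγ e' with ⟨e₂, h3, h4⟩ | ⟨e₂, h3, h4⟩ <;> rw [h2, h4] at h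
    · refine D.arcs_disjoint e₁ e₂ ?_ s t h
      rintro rfl
      exact hee (Subtype.ext (h1.trans h3.symm))
    · have := hD' e₁ s
      rw [h] at this
      linarith [hE' e₂ t]
    · have := hE' e₁ s
      rw [h] at this
      linarith [hD' e₂ t]
    · refine E.arcs_disjoint e₁ e₂ ?_ s t h
      rintro rfl
      exact hee (Subtype.ext (h1.trans h3.symm))

/-- The injective continuous map `(x, y) ↦ (σ exp x, y)` of the plane. -/
noncomputable def halfPlaneMap (σ : ℝ) : C(EuclideanSpace ℝ (Fin 2), EuclideanSpace ℝ (Fin 2)) :=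
  ⟨fun v => !₂[σ * Real.exp (v 0), v 1], by fun_prop⟩

theorem halfPlaneMap_apply_zero (σ : ℝ) (v : EuclideanSpace ℝ (Fin 2)) :
    halfPlaneMap σ v 0 = σ * Real.exp (v 0) := rfl

theorem halfPlaneMap_injective {σ : ℝ} (hσ : σ ≠ 0) : Function.Injective (halfPlaneMap σ) := by
  intro v w h
  have h0 : σ * Real.exp (v 0) = σ * Real.exp (w 0) := congrArg (fun u => u 0) h
  have h1 : v 1 = w 1 := congrArg (fun u => u 1) h
  ext i
  fin_cases i
  · exact Real.exp_injective (mul_left_cancel₀ hσ h0)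
  · exact h1

/-- The maps `(x, y) ↦ (± exp x, y)` push the two drawings into opposite open half-planes. -/
theorem IsPlanar.sum {V W : Type*} {f : V → V → ℕ} {g : W → W → ℕ} {hf : RainbowFree f}
    {hg : RainbowFree g} (hG : IsPlanar hf.toGraph) (hH : IsPlanar hg.toGraph) :
    IsPlanar (hf.sum hg).toGraph := by
  obtain ⟨D⟩ := hG
  obtain ⟨E⟩ := hH
  have hpos : ∀ v, 0 < halfPlaneMap 1 v 0 := fun v => by
    rw [halfPlaneMap_apply_zero, one_mul]
    exact Real.exp_pos _
  have hneg : ∀ v, halfPlaneMap (-1) v 0 < 0 := fun v => by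
    rw [halfPlaneMap_apply_zero, neg_one_mul, neg_lt_zero]
    exact Real.exp_pos _
  exact (D.map (halfPlaneMap 1) (halfPlaneMap_injective one_ne_zero)).sum
    (E.map (halfPlaneMap (-1)) (halfPlaneMap_injective (by norm_num)))
    (fun v => hpos _) (fun e t => hpos _) (fun v => hneg _) (fun e t => hneg _)
    (fun a b h => h) (fun a b h => h) (fun a b h => h rfl)

end RainbowPlanar

/-! ### Straight-line drawings and the extremal graphs. -/

namespace RainbowPlanar

open SimpleGraph

/-- Twice the signed area of the triangle `u v w`. -/
def orient (u v w : ℤ × ℤ) : ℤ :=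
  (v.1 - u.1) * (w.2 - u.2) - (v.2 - u.2) * (w.1 - u.1)

/-- Twice the signed area of the triangle `u v w`. -/
def realOrient (u v w : EuclideanSpace ℝ (Fin 2)) : ℝ :=
  (v 0 - u 0) * (w 1 - u 1) - (v 1 - u 1) * (w 0 - u 0)

/-- An integral point as a point of the Euclidean plane. -/
noncomputable def planePoint (u : ℤ × ℤ) : EuclideanSpace ℝ (Fin 2) := !₂[(u.1 : ℝ), (u.2 : ℝ)]

theorem realOrient_planePoint (u v w : ℤ × ℤ) :
    realOrient (planePoint u) (planePoint v) (planePoint w) = orient u v w := by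
  simp [realOrient, planePoint, orient]

/-- The segment from `u` to `v`. -/
noncomputable def segmentMap (u v : EuclideanSpace ℝ (Fin 2)) :
    C(unitInterval, EuclideanSpace ℝ (Fin 2)) :=
  ⟨fun t => (1 - (t : ℝ)) • u + (t : ℝ) • v, by fun_prop⟩

theorem segmentMap_apply (u v : EuclideanSpace ℝ (Fin 2)) (t : unitInterval) (i : Fin 2) :
    segmentMap u v t i = (1 - t) * u i + t * v i := by
  simp [segmentMap]

theorem segmentMap_zero (u v : EuclideanSpace ℝ (Fin 2)) : segmentMap u v 0 = u := by
  simp [segmentMap]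

theorem segmentMap_one (u v : EuclideanSpace ℝ (Fin 2)) : segmentMap u v 1 = v := by
  simp [segmentMap]

theorem segmentMap_injective {u v : EuclideanSpace ℝ (Fin 2)} (h : u ≠ v) :
    Function.Injective (segmentMap u v) := by
  intro s t hst
  by_contra hne
  have hne' : (s : ℝ) - t ≠ 0 := sub_ne_zero.2 fun h' => hne (Subtype.ext h')
  refine h ?_
  ext i
  have h1 := congrArg (fun w => w i) hst
  simp only [segmentMap_apply] at h1
  refine mul_left_cancel₀ hne' ?_
  linarith

theorem realOrient_segmentMap (u v w z : EuclideanSpace ℝ (Fin 2)) (t : unitInterval) :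
    realOrient u v (segmentMap w z t) = (1 - t) * realOrient u v w + t * realOrient u v z := by
  simp only [realOrient, segmentMap_apply]
  ring

theorem realOrient_segmentMap_self (u v : EuclideanSpace ℝ (Fin 2)) (t : unitInterval) :
    realOrient u v (segmentMap u v t) = 0 := by
  simp only [realOrient, segmentMap_apply]
  ring

theorem convex_combination_ne_zero {x y : ℝ} (h : 0 < x * y) (t : unitInterval) :
    (1 - (t : ℝ)) * x + t * y ≠ 0 := by
  have h0 := t.2.1
  have h1 := t.2.2
  rcases pos_and_pos_or_neg_and_neg_of_mul_pos h with ⟨hx, hy⟩ | ⟨hx, hy⟩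
  · refine ne_of_gt ?_
    rcases h0.eq_or_lt with h2 | h2
    · rw [← h2]
      simpa using hx
    · have := mul_pos h2 hy
      have := mul_nonneg (sub_nonneg.2 h1) hx.le
      linarith
  · refine ne_of_lt ?_
    rcases h0.eq_or_lt with h2 | h2
    · rw [← h2]
      simpa using hx
    · have := mul_neg_of_pos_of_neg h2 hy
      have := mul_nonpos_of_nonneg_of_nonpos (sub_nonneg.2 h1) hx.le
      linarith

/-- Integral points in general position so that the segments joining adjacent ones do not cross. -/
structure StraightDrawing {V : Type*} (f : V → V → ℕ) (q : V → ℤ × ℤ) : Prop where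
  injective : ∀ a b, q a = q b → a = b
  general : ∀ a b c, a ≠ b → a ≠ c → b ≠ c → orient (q a) (q b) (q c) ≠ 0
  noncrossing : ∀ a b, f a b ≠ 0 → ∀ c d, f c d ≠ 0 → a ≠ c → a ≠ d → b ≠ c → b ≠ d →
    0 < orient (q a) (q b) (q c) * orient (q a) (q b) (q d) ∨
    0 < orient (q c) (q d) (q a) * orient (q c) (q d) (q b)

namespace StraightDrawing

variable {V : Type*} {f : V → V → ℕ} {q : V → ℤ × ℤ}

theorem planePoint_injective (S : StraightDrawing f q) :
    Function.Injective fun v => planePoint (q v) := by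
  intro a b h
  have h0 := congrArg (fun w => w 0) h
  have h1 := congrArg (fun w => w 1) h
  simp only [planePoint, PiLp.toLp_apply, Matrix.cons_val_zero, Matrix.cons_val_one,
    Int.cast_inj] at h0 h1
  exact S.injective a b (Prod.ext h0 h1)

theorem realOrient_ne_zero (S : StraightDrawing f q) {a b c : V} (hab : a ≠ b) (hac : a ≠ c)
    (hbc : b ≠ c) : realOrient (planePoint (q a)) (planePoint (q b)) (planePoint (q c)) ≠ 0 := by
  rw [realOrient_planePoint]
  exact_mod_cast S.general a b c hab hac hbc

theorem mem_ends (S : StraightDrawing f q) {a b v : V} (hab : a ≠ b) {t : unitInterval}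
    (h : segmentMap (planePoint (q a)) (planePoint (q b)) t = planePoint (q v)) :
    t = 0 ∨ t = 1 := by
  have hinj := segmentMap_injective (S.planePoint_injective.ne hab)
  by_cases hva : a = v
  · left
    apply hinj
    rw [h, segmentMap_zero, hva]
  by_cases hvb : b = v
  · right
    apply hinj
    rw [h, segmentMap_one, hvb]
  exfalso
  refine S.realOrient_ne_zero hab hva hvb ?_
  rw [← h, realOrient_segmentMap_self]

/-- Orientation relative to one segment is affine along the other and vanishes at a common point. If
an end is shared, general position leaves only that end; otherwise two ends on the same side rule
out a zero. -/
theorem eq_vertex (S : StraightDrawing f q) {a b c d : V} (hab : f a b ≠ 0) (hcd : f c d ≠ 0)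
    (ha : a ≠ b) (hc : c ≠ d) (hne : s(a, b) ≠ s(c, d)) {s t : unitInterval}
    (h : segmentMap (planePoint (q a)) (planePoint (q b)) s =
      segmentMap (planePoint (q c)) (planePoint (q d)) t) :
    ∃ v, segmentMap (planePoint (q a)) (planePoint (q b)) s = planePoint (q v) := by
  have h1 := realOrient_segmentMap_self (planePoint (q a)) (planePoint (q b)) s
  have h2 := realOrient_segmentMap_self (planePoint (q c)) (planePoint (q d)) t
  rw [h, realOrient_segmentMap] at h1
  rw [← h, realOrient_segmentMap] at h2
  have hzero : ∀ x y : V, realOrient (planePoint (q x)) (planePoint (q y)) (planePoint (q x)) = 0 ∧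
      realOrient (planePoint (q x)) (planePoint (q y)) (planePoint (q y)) = 0 := fun x y => by
    constructor <;> simp only [realOrient] <;> ring
  by_cases hcab : a = c ∨ b = c
  · refine ⟨c, ?_⟩
    have hz : realOrient (planePoint (q a)) (planePoint (q b)) (planePoint (q c)) = 0 := by
      rcases hcab with rfl | rfl
      exacts [(hzero _ _).1, (hzero _ _).2]
    rw [hz, mul_zero, zero_add, mul_eq_zero] at h1
    rcases h1 with h1 | h1
    · rw [h, show t = 0 from Subtype.ext h1, segmentMap_zero]
    · refine absurd h1 (S.realOrient_ne_zero ha ?_ ?_)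
      · rintro rfl
        rcases hcab with rfl | rfl
        exacts [hc rfl, hne Sym2.eq_swap]
      · rintro rfl
        rcases hcab with rfl | rfl
        exacts [hne rfl, hc rfl]
  by_cases hdab : a = d ∨ b = d
  · refine ⟨d, ?_⟩
    have hz : realOrient (planePoint (q a)) (planePoint (q b)) (planePoint (q d)) = 0 := by
      rcases hdab with rfl | rfl
      exacts [(hzero _ _).1, (hzero _ _).2]
    rw [hz, mul_zero, add_zero, mul_eq_zero] at h1
    rcases h1 with h1 | h1
    · rw [h, show t = 1 from Subtype.ext (sub_eq_zero.1 h1).symm, segmentMap_one]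
    · rw [not_or] at hcab
      exact absurd h1 (S.realOrient_ne_zero ha hcab.1 hcab.2)
  exfalso
  rw [not_or] at hcab hdab
  rcases S.noncrossing a b hab c d hcd hcab.1 hdab.1 hcab.2 hdab.2 with h3 | h3
  · refine convex_combination_ne_zero ?_ t h1
    rw [realOrient_planePoint, realOrient_planePoint]
    exact_mod_cast h3
  · refine convex_combination_ne_zero ?_ s h2
    rw [realOrient_planePoint, realOrient_planePoint]
    exact_mod_cast h3

theorem isPlanar (S : StraightDrawing f q) (H : RainbowFree f) : IsPlanar H.toGraph := by
  have hout : ∀ e : H.toGraph.edgeSet, ∃ a b, e.1 = s(a, b) ∧ f a b ≠ 0 ∧ a ≠ b := by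
    rintro ⟨e, he⟩
    induction e with | _ a b
    exact ⟨a, b, rfl, he, H.toGraph.ne_of_adj he⟩
  choose a b hab hf hne using hout
  refine ⟨⟨fun v => planePoint (q v),
    fun e => segmentMap (planePoint (q (a e))) (planePoint (q (b e))), S.planePoint_injective,
    fun e => segmentMap_injective (S.planePoint_injective.ne (hne e)), fun e => ?_,
    fun e t v h => S.mem_ends (hne e) h, fun e e' hee s t h => ?_⟩⟩
  · rw [segmentMap_zero, segmentMap_one, hab e, Sym2.map_mk]
  · obtain ⟨v, hv⟩ := S.eq_vertex (hf e) (hf e') (hne e) (hne e')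
      (by rwa [← hab, ← hab, Ne, ← Subtype.ext_iff]) h
    exact S.mem_ends (hne e) hv

end StraightDrawing

/-- There is a planar rainbow-`P₅`-free coloured graph with `n` vertices and `m` edges. -/
def Realizable (n m : ℕ) : Prop :=
  ∃ (f : Fin n → Fin n → ℕ) (H : RainbowFree f), IsPlanar H.toGraph ∧ ∑ a, deg f a = 2 * m

theorem Realizable.mem {n m : ℕ} (h : Realizable n m) :
    m ∈ rainbowFreePlanarEdgeCounts n (pathGraph 5) := by
  obtain ⟨f, H, hp, hm⟩ := h
  refine ⟨H.toGraph, H.coloring, hp, H.coloring_proper, H.not_containsRainbow, ?_⟩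
  rw [sum_deg_eq (G := H.toGraph) fun a b => Iff.rfl] at hm
  omega

theorem Realizable.add {n m n' m' : ℕ} (h : Realizable n m) (h' : Realizable n' m') :
    Realizable (n + n') (m + m') := by
  obtain ⟨f, H, hp, hm⟩ := h
  obtain ⟨g, K, hq, hm'⟩ := h'
  let e : Fin (n + n') ≃ Fin n ⊕ Fin n' := finSumFinEquiv.symm
  refine ⟨fun a b => sumColor f g (e a) (e b), (H.sum K).comap e.injective,
    (hp.sum hq).of_copy ⟨⟨e, fun h => h⟩, e.injective⟩, ?_⟩
  have hdeg : ∀ a, deg (fun a b => sumColor f g (e a) (e b)) a = deg (sumColor f g) (e a) :=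
    fun a => by
      rw [deg_eq_sum, deg_eq_sum]
      exact e.sum_comp fun b => if sumColor f g (e a) b ≠ 0 then 1 else 0
  rw [Finset.sum_congr rfl fun a _ => hdeg a, e.sum_comp (deg (sumColor f g)), sum_deg_sumColor,
    hm, hm', mul_add]

/-- Quantifiers and hypotheses alternate so that enumeration abandons a tuple at its first non-edge.
-/
theorem RainbowFree.of_forall_path {V : Type*} {f : V → V → ℕ} (h1 : ∀ a b, f a b = f b a)
    (h2 : ∀ a, f a a = 0) (h3 : ∀ a b c, f a b ≠ 0 → f a b = f a c → b = c)
    (h4 : ∀ a b, f a b ≠ 0 → ∀ c, f b c ≠ 0 → a ≠ c → ∀ d, f c d ≠ 0 → a ≠ d → b ≠ d →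
      f a b = f c d ∨ ∀ e, f d e ≠ 0 → a ≠ e → b ≠ e → c ≠ e → f a b = f d e ∨ f b c = f d e) :
    RainbowFree f :=
  ⟨h1, h2, h3, fun a b c d e hab hbc hcd hde hac had hae hbd hbe hce =>
    (h4 a b hab c hbc hac d hcd had hbd).imp id fun h => h e hde hae hbe hce⟩

theorem Realizable.of_straightDrawing {n m : ℕ} {f : Fin n → Fin n → ℕ} {q : Fin n → ℤ × ℤ}
    (H : RainbowFree f) (S : StraightDrawing f q) (hm : ∑ a, deg f a = 2 * m) : Realizable n m :=
  ⟨f, H, S.isPlanar H, hm⟩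

theorem realizable_four : Realizable 4 6 :=
  .of_straightDrawing (f := ![![0, 1, 2, 3], ![1, 0, 3, 2], ![2, 3, 0, 1], ![3, 2, 1, 0]])
    (q := ![(0, 1), (0, 0), (-1, -1), (1, 0)])
    (.of_forall_path (by decide) (by decide) (by decide) (by decide +kernel))
    ⟨by decide, by decide +kernel, by decide +kernel⟩ (by decide)

/-- `K₄` with a pendant edge: a path on all five vertices contains a Hamiltonian path of `K₄`, whose
end edges have the same colour. -/
theorem realizable_five : Realizable 5 7 :=
  .of_straightDrawing (f := ![![0, 1, 2, 3, 4], ![1, 0, 3, 2, 0], ![2, 3, 0, 1, 0],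
      ![3, 2, 1, 0, 0], ![4, 0, 0, 0, 0]])
    (q := ![(-1, 1), (0, 0), (1, 1), (0, -1), (-1, 0)])
    (.of_forall_path (by decide) (by decide) (by decide) (by decide +kernel))
    ⟨by decide, by decide +kernel, by decide +kernel⟩ (by decide)

/-- The triangular prism, each rung coloured like the two triangle sides that avoid it. -/
theorem realizable_six : Realizable 6 9 :=
  .of_straightDrawing (f := ![![0, 3, 2, 1, 0, 0], ![3, 0, 1, 0, 2, 0], ![2, 1, 0, 0, 0, 3],
      ![1, 0, 0, 0, 3, 2], ![0, 2, 0, 3, 0, 1], ![0, 0, 3, 2, 1, 0]])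
    (q := ![(-1, 0), (-1, 1), (-2, -1), (0, 0), (2, 2), (1, -2)])
    (.of_forall_path (by decide) (by decide) (by decide) (by decide +kernel))
    ⟨by decide, by decide +kernel, by decide +kernel⟩ (by decide)

/-- `K₃,₄` without two edges at one vertex of the smaller class. -/
theorem realizable_seven : Realizable 7 10 :=
  .of_straightDrawing (f := ![![0, 0, 0, 1, 2, 3, 4], ![0, 0, 0, 2, 1, 4, 3],
      ![0, 0, 0, 3, 4, 0, 0], ![1, 2, 3, 0, 0, 0, 0], ![2, 1, 4, 0, 0, 0, 0],
      ![3, 4, 0, 0, 0, 0, 0], ![4, 3, 0, 0, 0, 0, 0]])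
    (q := ![(2, 1), (-2, -2), (0, 0), (0, 1), (1, 0), (1, -2), (-2, 2)])
    (.of_forall_path (by decide) (by decide) (by decide) (by decide +kernel))
    ⟨by decide, by decide +kernel, by decide +kernel⟩ (by decide)

theorem realizable (n : ℕ) (hn : 4 ≤ n) : Realizable n (3 * n / 2) := by
  induction n using Nat.strong_induction_on with | _ n ih
  by_cases h : n < 8
  · interval_cases n
    exacts [realizable_four, realizable_five, realizable_six, realizable_seven]
  -- A disjoint `K₄` raises both the number of edges and `3 * n / 2` by exactly six, so the values
  -- from four to seven suffice as a base.
  · have h1 := (ih (n - 4) (by omega) (by omega)).add realizable_four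
    rwa [show n - 4 + 4 = n by omega, show 3 * (n - 4) / 2 + 6 = 3 * n / 2 by omega] at h1

end RainbowPlanar

theorem theorem3p1 (n : ℕ) (hn : 4 ≤ n) :
    RainbowPlanar.IsRainbowPlanarTuranNumber n (SimpleGraph.pathGraph 5) (3 * n / 2) := by
  refine ⟨(RainbowPlanar.realizable n hn).mem, ?_⟩
  rintro m ⟨G, c, hG, hc, hr, rfl⟩
  exact RainbowPlanar.edge_ncard_le hG hc hr
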